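/- **Theorem (Approximation of the spectral density function).** *Setting.* Let $X\subset\mathbb R^m$ be compact, with the metric induced by a norm, and let $\mu$ be a finite Borel measure on $X$ that is absolutely continuous with respect to Lebesgue measure and satisfies $\operatorname{supp}\mu=X$. Let $T:X\to X$ be a continuous bijection (hence a homeomorphism) that preserves $\mu$, and let $\mathcal U g=g\circ T$ be its (unitary) Koopman operator on $L^2(X,\mu)$. *Partitions.* Let $\mathcal P_n=\{p_{n,1},\dots,p_{n,q(n)}\}$ be a sequence of covers of $X$ by compact connected sets with $\mu(p_{n,j})=\mu(X)/q(n)$, where $q$ is strictly increasing, with $\operatorname{diam}p_{n,j}\le l(n)$ for a positive non-increasing sequence $l(n)\to0$, and such that for $n>m$ every $p_{m,j}$ is a union of elements of $\mathcal P_n$. Let $T_n:\mathcal P_n\to\mathcal P_n$ be bijections that periodically approximate $T$: for every $k\in\mathbb N$ and every compact $A\subset X$, $$\lim_{n\to\infty}\sum_{l=-k}^{k}d_H\big(T^l(A),T_n^l(A_n)\big)=0,\qquad A_n=\bigcup_{p\in\mathcal P_n,\ p\cap A\neq\emptyset}p,$$ where $d_H$ is the Hausdorff distance and $T_n^l$ acts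 on a union of elements of $\mathcal P_n$ elementwise. *Discrete operators.* Let $L^2_n$ be the span of the indicator functions $\chi_{p_{n,j}}$. For $g\in L^2(X,\mu)$ put $g_n=\sum_j g_{n,j}\chi_{p_{n,j}}$ with $g_{n,j}=\frac{q(n)}{\mu(X)}\int_{p_{n,j}}g\,d\mu$. Let $\mathcal U_n:L^2_n\to L^2_n$ be given by $\mathcal U_n\big(\sum_j c_j\chi_{p_{n,j}}\big)=\sum_j c_j\chi_{T_n^{-1}(p_{n,j})}$. *Spectral density.* A spectral resolution of $\mathcal U$ is a projection-valued measure $\mathcal S$ on the Borel sets of the circle $[-\pi,\pi)$ with $\mathcal U^k=\int_{-\pi}^{\pi}e^{i\theta k}\,d\mathcal S(\theta)$ for all $k\in\mathbb Z$. Given $\mathcal S$, let $c(\theta;g)=\langle\mathcal S_{[-\pi,\theta)}g,g\rangle$. The spectral density $\rho(\cdot;g)=dc(\cdot;g)$ is the finite positive measure $D\mapsto\langle\mathcal S_Dg,g\rangle$ on $[-\pi,\pi)$; it is the distributional derivative of $c(\cdot;g)$ on the circle in the sense that, for smooth $2\pi$-periodic $\varphi$, $$\int_{-\pi}^{\pi}\varphi'(\theta)\,c(\theta;g)\,d\theta=\varphi(\pi)\|g\|^2-\int_{-\pi}^{\pi}\varphi(\theta)\,\rho(\theta;g)\,d\theta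 .$$ *Discrete spectral density.* For orthonormal eigenvectors $v_{n,1},\dots,v_{n,q(n)}\in L^2_n$ with $\mathcal U_nv_{n,k}=e^{i\theta_{n,k}}v_{n,k}$ and $\theta_{n,k}\in[-\pi,\pi)$, put $$\rho_n(\theta;g_n)=\sum_{k=1}^{q(n)}\|\mathcal S_n(\theta_{n,k})g_n\|^2\,\delta(\theta-\theta_{n,k}),\qquad \mathcal S_n(\theta_{n,k})g_n=v_{n,k}\langle v_{n,k},g_n\rangle .$$ *Smoothing.* For $0<\alpha<2\pi$ and $x,y\in[-\pi,\pi)$ let $$\varphi_\alpha(x,y)=\begin{cases}\dfrac K\alpha\exp\!\left(\dfrac{-1}{1-(d(x,y)/\alpha)^2}\right)& d(x,y)<\alpha,\\[1ex]0&\text{otherwise,}\end{cases}\qquad K=\Big(\int_{-1}^1e^{-1/(1-x^2)}dx\Big)^{-1},$$ where $d(x,y)=\min\{|x-y|,2\pi-|x-y|\}$ is the arc-length distance on the circle, and put $$\rho_\alpha(\theta;g)=\int_{-\pi}^{\pi}\varphi_\alpha(\theta,\xi)\,\rho(\xi;g)\,d\xi,\qquad \rho_{\alpha,n}(\theta;g_n)=\int_{-\pi}^{\pi}\varphi_\alpha(\theta,\xi)\,\rho_n(\xi;g_n)\,d\xi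 .$$ *Claim.* A spectral resolution $\mathcal S$ of $\mathcal U$ exists, and for every $n$ there are orthonormal eigenvectors and eigenphases as above. For every spectral resolution $\mathcal S$ of $\mathcal U$, every choice of such eigenvectors and eigenphases, every $g\in L^2(X,\mu)$ and every $0<\alpha<2\pi$, $$\lim_{n\to\infty}\rho_{\alpha,n}(\theta;g_n)=\rho_\alpha(\theta;g)\qquad\text{uniformly in }\theta\in[-\pi,\pi).$$ -/

import Mathlib

open MeasureTheory Filter Topology

noncomputable section

namespace KoopmanSpectra

/-! ### Projection-valued measures and the spectral resolution of a unitary operator -/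

/-- A projection-valued measure on a measurable space `Ω`, acting on a complex Hilbert space `H`.
The values of `proj` on non-measurable sets play no role. -/
structure ProjectionValuedMeasure (Ω : Type*) [MeasurableSpace Ω]
    (H : Type*) [NormedAddCommGroup H] [InnerProductSpace ℂ H] [CompleteSpace H] where
  proj : Set Ω → H →L[ℂ] H
  isStarProjection : ∀ D, MeasurableSet D → IsStarProjection (proj D)
  proj_empty : proj ∅ = 0
  proj_univ : proj Set.univ = 1
  orthogonal : ∀ D₁ D₂, MeasurableSet D₁ → MeasurableSet D₂ → Disjoint D₁ D₂ →
    ∀ g h : H, inner ℂ (proj D₁ g) (proj D₂ h) = 0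
  tendsto_iUnion : ∀ D : ℕ → Set Ω, (∀ k, MeasurableSet (D k)) →
    Pairwise (fun i j => Disjoint (D i) (D j)) → ∀ g : H,
    Tendsto (fun m => ∑ k ∈ Finset.range m, proj (D k) g) atTop (𝓝 (proj (⋃ k, D k) g))

section Spectral

variable {Ω : Type*} [MeasurableSpace Ω]
  {H : Type*} [NormedAddCommGroup H] [InnerProductSpace ℂ H] [CompleteSpace H]

theorem ProjectionValuedMeasure.re_inner_proj (S : ProjectionValuedMeasure Ω H) {D : Set Ω}
    (hD : MeasurableSet D) (g : H) : (inner ℂ (S.proj D g) g).re = ‖S.proj D g‖ ^ 2 := by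
  have h := S.isStarProjection D hD
  have h1 : S.proj D (S.proj D g) = S.proj D g := by
    have := congrArg (fun A : H →L[ℂ] H => A g) h.isIdempotentElem.eq
    simpa using this
  have h2 : ContinuousLinearMap.adjoint (S.proj D) = S.proj D := h.isSelfAdjoint.star_eq
  have h3 : inner ℂ (S.proj D g) g = inner ℂ (S.proj D g) (S.proj D g) := by
    conv_lhs => rw [← h1]
    rw [← ContinuousLinearMap.adjoint_inner_right, h2]
  rw [h3]
  exact (norm_sq_eq_re_inner (𝕜 := ℂ) (S.proj D g)).symm

/-- The finite Borel measure `D ↦ ⟨S_D g, g⟩`. -/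
def ProjectionValuedMeasure.scalarMeasure (S : ProjectionValuedMeasure Ω H) (g : H) : Measure Ω :=
  Measure.ofMeasurable (fun D _ => ENNReal.ofReal (inner ℂ (S.proj D g) g).re)
    (by simp [S.proj_empty])
    (by
      intro D hD hdis
      have h0 : ∀ k, 0 ≤ (inner ℂ (S.proj (D k) g) g).re := fun k => by
        rw [S.re_inner_proj (hD k)]; positivity
      have ht : Tendsto (fun m => ∑ k ∈ Finset.range m, (inner ℂ (S.proj (D k) g) g).re) atTop
          (𝓝 (inner ℂ (S.proj (⋃ k, D k) g) g).re) := by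
        have h1 := S.tendsto_iUnion D hD hdis g
        have h2 := (Complex.continuous_re.tendsto _).comp
          (h1.inner (tendsto_const_nhds (x := g)) (𝕜 := ℂ))
        refine h2.congr fun m => ?_
        simp [sum_inner]
      have hs : HasSum (fun k => (inner ℂ (S.proj (D k) g) g).re)
          (inner ℂ (S.proj (⋃ k, D k) g) g).re :=
        (hasSum_iff_tendsto_nat_of_nonneg h0 _).2 ht
      rw [← hs.tsum_eq, ENNReal.ofReal_tsum_of_nonneg h0 hs.summable])

theorem ProjectionValuedMeasure.scalarMeasure_apply (S : ProjectionValuedMeasure Ω H) (g : H)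
    {D : Set Ω} (hD : MeasurableSet D) :
    S.scalarMeasure g D = ENNReal.ofReal (inner ℂ (S.proj D g) g).re :=
  Measure.ofMeasurable_apply D hD

/-- The circle, parametrized by `[-π, π)`. -/
abbrev Phase : Type := Set.Ico (-Real.pi) Real.pi

/-- `S` is the spectral resolution of the unitary operator `U`:
`U ^ k = ∫ exp (i θ k) dS(θ)` for all integers `k`. The integral against `S` is understood weakly,
and by polarization the diagonal matrix elements determine the operator. -/
def IsSpectralResolution (U : H ≃ₗᵢ[ℂ] H) (S : ProjectionValuedMeasure Phase H) : Prop :=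
  ∀ (k : ℤ) (g : H),
    inner ℂ g ((U ^ k) g) =
      ∫ θ : Phase, Complex.exp (Complex.I * ((θ : ℝ) : ℂ) * (k : ℂ)) ∂(S.scalarMeasure g)

/-- The spectral cumulative function `c(θ; g) = ⟨S_{[-π, θ)} g, g⟩`. -/
def spectralCumulative (S : ProjectionValuedMeasure Phase H) (g : H) (θ : ℝ) : ℝ :=
  (inner ℂ (S.proj {ξ : Phase | (ξ : ℝ) < θ} g) g).re

/-- The spectral density `ρ(·; g)`: the distributional derivative `dc(·; g)` of the spectral
cumulative function on the circle. It is a positive distribution of order zero, hence given as a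
measure; `spectralDensity_eq_deriv` is its description as a derivative. -/
def spectralDensity (S : ProjectionValuedMeasure Phase H) (g : H) : Measure Phase :=
  S.scalarMeasure g

instance (S : ProjectionValuedMeasure Phase H) (g : H) :
    IsFiniteMeasure (spectralDensity S g) :=
  ⟨by rw [spectralDensity, S.scalarMeasure_apply g MeasurableSet.univ]
      exact ENNReal.ofReal_lt_top⟩

theorem spectralDensity_Iio (S : ProjectionValuedMeasure Phase H) (g : H) (θ : ℝ) :
    (spectralDensity S g).real {ξ : Phase | (ξ : ℝ) < θ} = spectralCumulative S g θ := by
  have hm : MeasurableSet {ξ : Phase | (ξ : ℝ) < θ} :=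
    measurableSet_lt measurable_subtype_coe measurable_const
  rw [Measure.real, spectralDensity, S.scalarMeasure_apply g hm, spectralCumulative,
    ENNReal.toReal_ofReal]
  rw [S.re_inner_proj hm]; positivity

/-- The defining property of the distributional derivative of `c(·; g)` on the circle. The
boundary term accounts for the fact that `c(·; g)`, continued from `[-π, π)` to the line,
increases by `‖g‖ ^ 2` with each turn. -/
theorem spectralDensity_eq_deriv (S : ProjectionValuedMeasure Phase H) (g : H) (φ : ℝ → ℝ)
    (hφ : ContDiff ℝ 1 φ) :
    ∫ θ in (-Real.pi)..Real.pi, deriv φ θ * spectralCumulative S g θ =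
      φ Real.pi * ‖g‖ ^ 2 - ∫ ξ : Phase, φ ξ ∂(spectralDensity S g) := by
  have hpi : -Real.pi ≤ Real.pi := by linarith [Real.pi_pos]
  have hd : Continuous (deriv φ) := hφ.continuous_deriv le_rfl
  have hm : MeasurableSet {z : ℝ × Phase | (z.2 : ℝ) < z.1} :=
    measurableSet_lt (measurable_subtype_coe.comp measurable_snd) measurable_fst
  set F : ℝ → Phase → ℝ := fun θ ξ => if (ξ : ℝ) < θ then deriv φ θ else 0 with hF
  have hFi : Function.uncurry F =
      Set.indicator {z : ℝ × Phase | (z.2 : ℝ) < z.1} (fun z => deriv φ z.1) := by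
    funext z
    simp [hF, Function.uncurry, Set.indicator]
  have hint : Integrable (Function.uncurry F)
      ((volume.restrict (Set.Ioc (-Real.pi) Real.pi)).prod (spectralDensity S g)) := by
    rw [hFi]
    refine Integrable.indicator ?_ hm
    have : Integrable (deriv φ) (volume.restrict (Set.Ioc (-Real.pi) Real.pi)) :=
      (hd.integrableOn_Icc (a := -Real.pi) (b := Real.pi)).mono_set Set.Ioc_subset_Icc_self
    exact this.comp_fst _
  have hl : ∀ θ, deriv φ θ * spectralCumulative S g θ = ∫ ξ, F θ ξ ∂(spectralDensity S g) := by
    intro θ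
    have hmθ : MeasurableSet {ξ : Phase | (ξ : ℝ) < θ} :=
      measurableSet_lt measurable_subtype_coe measurable_const
    have : F θ = Set.indicator {ξ : Phase | (ξ : ℝ) < θ} (fun _ => deriv φ θ) := by
      funext ξ
      simp [hF, Set.indicator]
    rw [this, integral_indicator_const _ hmθ, spectralDensity_Iio, smul_eq_mul, mul_comm]
  have hr : ∀ ξ : Phase, ∫ θ in Set.Ioc (-Real.pi) Real.pi, F θ ξ = φ Real.pi - φ ξ := by
    intro ξ
    have : (fun θ => F θ ξ) = Set.indicator (Set.Ioi (ξ : ℝ)) (deriv φ) := by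
      funext θ
      simp [hF, Set.indicator]
    rw [this, setIntegral_indicator measurableSet_Ioi]
    have hs : Set.Ioc (-Real.pi) Real.pi ∩ Set.Ioi (ξ : ℝ) = Set.Ioc (ξ : ℝ) Real.pi := by
      ext θ
      have := ξ.2.1
      simp only [Set.mem_inter_iff, Set.mem_Ioc, Set.mem_Ioi]
      constructor
      · rintro ⟨⟨_, h2⟩, h3⟩; exact ⟨h3, h2⟩
      · rintro ⟨h1, h2⟩; exact ⟨⟨by linarith, h2⟩, h1⟩
    rw [hs, ← intervalIntegral.integral_of_le ξ.2.2.le]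
    exact intervalIntegral.integral_deriv_eq_sub
      (fun x _ => (hφ.differentiable one_ne_zero).differentiableAt) (hd.intervalIntegrable _ _)
  have hφi : Integrable (fun ξ : Phase => φ ξ) (spectralDensity S g) := by
    obtain ⟨C, hC⟩ := (isCompact_Icc (a := -Real.pi) (b := Real.pi)).exists_bound_of_continuousOn
      hφ.continuous.continuousOn
    exact Integrable.of_bound
      (hφ.continuous.measurable.comp measurable_subtype_coe).aestronglyMeasurable C
      (Eventually.of_forall fun ξ => hC ξ ⟨ξ.2.1, ξ.2.2.le⟩)
  have htot : (spectralDensity S g).real Set.univ = ‖g‖ ^ 2 := by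
    rw [Measure.real, spectralDensity, S.scalarMeasure_apply g MeasurableSet.univ,
      S.re_inner_proj MeasurableSet.univ, S.proj_univ, ENNReal.toReal_ofReal (by positivity)]
    simp
  rw [intervalIntegral.integral_of_le hpi]
  simp_rw [hl]
  rw [integral_integral_swap hint]
  simp_rw [hr]
  rw [integral_sub (integrable_const _) hφi, integral_const, htot, smul_eq_mul, mul_comm]

end Spectral

/-! ### The Koopman operator -/

section Koopman

variable {X : Type*} [MetricSpace X] [MeasurableSpace X] [BorelSpace X] {μ : Measure X}

/-- The Koopman operator `g ↦ g ∘ T` on `L²(X, μ)`. -/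
def koopman (T : X ≃ₜ X) (hT : MeasurePreserving T μ μ) : Lp ℂ 2 μ ≃ₗᵢ[ℂ] Lp ℂ 2 μ :=
  LinearIsometryEquiv.ofSurjective (Lp.compMeasurePreservingₗᵢ ℂ T hT) (by
    intro g
    have hT' : MeasurePreserving T.symm μ μ := hT.symm T.toMeasurableEquiv
    refine ⟨Lp.compMeasurePreserving T.symm hT' g, ?_⟩
    change Lp.compMeasurePreserving T hT (Lp.compMeasurePreserving T.symm hT' g) = g
    rw [← Lp.compMeasurePreserving_comp_apply g hT' hT]
    simp)

theorem koopman_coeFn (T : X ≃ₜ X) (hT : MeasurePreserving T μ μ) (g : Lp ℂ 2 μ) :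
    koopman T hT g =ᵐ[μ] g ∘ T :=
  Lp.coeFn_compMeasurePreserving g hT

end Koopman

/-! ### Partitions, discrete maps and discrete Koopman operators -/

/-- A sequence of successively refined partitions `𝒫 n = {p n 1, …, p n (q n)}` of `X` into compact
connected sets of equal measure whose diameters tend to zero. Distinct elements may overlap; since
they cover `X` and have measure `μ X / q n`, the overlaps are null sets. -/
structure PartitionSequence {X : Type*} [MetricSpace X] [MeasurableSpace X]
    (μ : Measure X) where
  q : ℕ → ℕ
  q_strictMono : StrictMono q
  p : (n : ℕ) → Fin (q n) → Set X
  iUnion_eq : ∀ n, ⋃ j, p n j = Set.univ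
  isCompact : ∀ n j, IsCompact (p n j)
  isConnected : ∀ n j, IsConnected (p n j)
  measure_eq : ∀ n j, μ (p n j) = μ Set.univ / (q n : ENNReal)
  l : ℕ → ℝ
  l_pos : ∀ n, 0 < l n
  l_antitone : Antitone l
  l_tendsto : Tendsto l atTop (𝓝 0)
  diam_le : ∀ n j, Metric.diam (p n j) ≤ l n
  refines : ∀ m n, m < n → ∀ j, ∃ s : Finset (Fin (q n)), p m j = ⋃ i ∈ s, p n i

namespace PartitionSequence

variable {X : Type*} [MetricSpace X] [MeasurableSpace X] [BorelSpace X] {μ : Measure X}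

/-- The sets `T^l (A)` and `T_n^l (A_n)` become close in the Hausdorff metric, where
`A_n` is the union of the elements of `𝒫 n` that meet `A`. The bijection `T_n` of `𝒫 n` is given by
the permutation `σ n` of the indices, `T_n (p n j) = p n (σ n j)`. -/
def PeriodicallyApproximates (P : PartitionSequence μ) (σ : (n : ℕ) → Equiv.Perm (Fin (P.q n)))
    (T : X ≃ₜ X) : Prop :=
  ∀ (k : ℕ) (A : Set X), IsCompact A →
    Tendsto (fun n => ∑ l ∈ Finset.Icc (-(k : ℤ)) (k : ℤ),
      Metric.hausdorffDist ((T ^ l : X ≃ₜ X) '' A)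
        (⋃ j ∈ {j | (P.p n j ∩ A).Nonempty}, P.p n ((σ n ^ l) j))) atTop (𝓝 0)

variable [IsFiniteMeasure μ]

/-- The indicator function of `p n j`, as an element of `L²(X, μ)`. -/
def indicator (P : PartitionSequence μ) (n : ℕ) (j : Fin (P.q n)) : Lp ℂ 2 μ :=
  indicatorConstLp 2 (P.isCompact n j).measurableSet (measure_ne_top μ _) (1 : ℂ)

/-- The space `L²_n` of linear combinations of the indicator functions of `𝒫 n`. -/
def discreteSpace (P : PartitionSequence μ) (n : ℕ) : Submodule ℂ (Lp ℂ 2 μ) :=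
  Submodule.span ℂ (Set.range (P.indicator n))

/-- The average `g_{n,j} = (q n / μ X) ∫_{p n j} g dμ`. For `g` in `L²_n` it is the coefficient of
`g` at the indicator function of `p n j`. -/
def average (P : PartitionSequence μ) (n : ℕ) (g : Lp ℂ 2 μ) (j : Fin (P.q n)) : ℂ :=
  ((P.q n : ℂ) / ((μ.real Set.univ : ℝ) : ℂ)) * ∫ x in P.p n j, g x ∂μ

/-- The averaging operator `W_n g = g_n = ∑ j, g_{n,j} χ_{p n j}`. -/
def discretize (P : PartitionSequence μ) (n : ℕ) (g : Lp ℂ 2 μ) : Lp ℂ 2 μ :=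
  ∑ j, P.average n g j • P.indicator n j

/-- The discrete Koopman operator `U_n g_n = ∑ j, g_{n,j} χ_{T_n⁻¹ (p n j)}`, for `g_n` in `L²_n`
and `T_n (p n j) = p n (σ j)`. -/
def discreteKoopman (P : PartitionSequence μ) (n : ℕ) (σ : Equiv.Perm (Fin (P.q n)))
    (g : Lp ℂ 2 μ) : Lp ℂ 2 μ :=
  ∑ j, P.average n g j • P.indicator n (σ⁻¹ j)

/-- `v 1, …, v (q n)` are orthonormal eigenvectors in `L²_n` of the discrete Koopman operator, with
eigenvalues `exp (i θ k)`. -/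
structure IsEigenbasis (P : PartitionSequence μ) (n : ℕ) (σ : Equiv.Perm (Fin (P.q n)))
    (v : Fin (P.q n) → Lp ℂ 2 μ) (θ : Fin (P.q n) → Phase) : Prop where
  mem : ∀ k, v k ∈ P.discreteSpace n
  orthonormal : Orthonormal ℂ v
  eigen : ∀ k, P.discreteKoopman n σ (v k) =
    Complex.exp (Complex.I * ((θ k : ℝ) : ℂ)) • v k

end PartitionSequence

/-- The rank-one projection `g ↦ v ⟨v, g⟩` onto the line spanned by a unit vector `v`. -/
def rankOneProj {H : Type*} [NormedAddCommGroup H] [InnerProductSpace ℂ H] (v g : H) : H :=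
  (inner ℂ v g : ℂ) • v

/-- The discrete spectral density `∑ k, ‖S(θ_k) g‖ ^ 2 δ(θ - θ_k)`, with `S(θ_k)` the rank-one
projection onto the line spanned by the unit vector `v k`. -/
def discreteDensity {H : Type*} [NormedAddCommGroup H] [InnerProductSpace ℂ H] {N : ℕ}
    (v : Fin N → H) (θ : Fin N → Phase) (g : H) : Measure Phase :=
  ∑ k, ENNReal.ofReal (‖rankOneProj (v k) g‖ ^ 2) • Measure.dirac (θ k)

/-! ### The smoothing kernel -/

/-- The arc-length distance on the circle `[-π, π)`. -/
def circleDist (x y : Phase) : ℝ :=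
  min |(x : ℝ) - y| (2 * Real.pi - |(x : ℝ) - y|)

/-- The kernel `φ_α(x, y)`. -/
def bumpKernel (α : ℝ) (x y : Phase) : ℝ :=
  if circleDist x y / α < 1 then
    (∫ t in (-1 : ℝ)..1, Real.exp (-1 / (1 - t ^ 2)))⁻¹ / α *
      Real.exp (-1 / (1 - (circleDist x y / α) ^ 2))
  else 0

/-- The smoothed density `θ ↦ ∫ φ_α(θ, ξ) ρ(ξ) dξ`. -/
def smoothDensity (α : ℝ) (ρ : Measure Phase) (θ : Phase) : ℝ :=
  ∫ ξ, bumpKernel α θ ξ ∂ρ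

end KoopmanSpectra

end

open KoopmanSpectra

open MeasureTheory Filter Topology

noncomputable section

namespace KoopmanSpectra

/-! Everything is reduced to Fourier coefficients on the circle. The `k`-th coefficient of the
spectral density is the autocorrelation ⟨g, U^k g⟩. That of the discrete density is ⟨g_n, U_n^k
g_n⟩, because the eigenvectors form an orthonormal basis of `L²_n` (`integral_discreteDensity_exp`).
So it suffices that `U_n^k g_n → U^k g` in `L²` (`tendsto_discreteKoopman`).

For continuous `f` the value of `U_n^k f_n` at almost every `x` is the mean of `f` over the cell
`T_n^k p`, where `p` is the cell of `x`. Periodic approximation applied to the compact set `{x}`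
puts this whole cell near `T^k x`, and dominated convergence gives `L²` convergence. Density of
continuous functions and contractivity extend this to all `g`.

Smoothing is convolution with a continuous function on the circle. Trigonometric polynomials are
uniformly dense and all the masses are at most `‖g‖ ^ 2`, so convergence of coefficients becomes
uniform convergence (`tendstoUniformly_smoothDensity`).

The spectral resolution comes from the continuous functional calculus: Riesz measures of vectors, an
isometry from their `L²` spaces into `H`, and the images of indicator functions under it. The
discrete eigenvectors come from diagonalizing a permutation matrix. -/

set_option linter.unusedSectionVars false

/-! ### Projection-valued measures from representations of `C(K, ℂ)`. -/

section SpectralTheorem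

open scoped CompactlySupported

variable {K : Type*} [MetricSpace K] [CompactSpace K] [MeasurableSpace K] [BorelSpace K]
  {H : Type*} [NormedAddCommGroup H] [InnerProductSpace ℂ H] [CompleteSpace H]

/-- A real continuous function, regarded as a complex one. -/
def complexify (f : C(K, ℝ)) : C(K, ℂ) := ⟨fun x => (f x : ℂ), by fun_prop⟩

/-- A real function is self-adjoint in `C(K, ℂ)`, so its image is a self-adjoint operator, whose
quadratic form is real. -/
theorem inner_map_complexify (Φ : C(K, ℂ) →⋆ₐ[ℂ] (H →L[ℂ] H)) (f : C(K, ℝ)) (g : H) :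
    (((inner ℂ g (Φ (complexify f) g)).re : ℝ) : ℂ) = inner ℂ g (Φ (complexify f) g) := by
  have h : star (complexify f) = complexify f := by
    ext x; simp [complexify]
  have h2 : ContinuousLinearMap.adjoint (Φ (complexify f)) = Φ (complexify f) := by
    rw [← ContinuousLinearMap.star_eq_adjoint, ← map_star, h]
  apply Complex.conj_eq_iff_re.1
  rw [inner_conj_symm]
  conv_lhs => rw [← h2]
  rw [ContinuousLinearMap.adjoint_inner_left]

theorem inner_map_star_mul (Φ : C(K, ℂ) →⋆ₐ[ℂ] (H →L[ℂ] H)) (f₁ f₂ : C(K, ℂ)) (g : H) :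
    inner ℂ (Φ f₁ g) (Φ f₂ g) = inner ℂ g (Φ (star f₁ * f₂) g) := by
  rw [map_mul, map_star, ContinuousLinearMap.star_eq_adjoint, mul_apply_eq_comp,
    ContinuousLinearMap.adjoint_inner_right]

/-- The positive functional `f ↦ ⟨g, Φ f g⟩`. -/
def vectorFunctional (Φ : C(K, ℂ) →⋆ₐ[ℂ] (H →L[ℂ] H)) (g : H) : C_c(K, ℝ) →ₚ[ℝ] ℝ :=
  PositiveLinearMap.mk₀
    { toFun := fun f => (inner ℂ g (Φ (complexify f) g)).re
      map_add' := by
        intro f₁ f₂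
        have : complexify ((f₁ + f₂ : C_c(K, ℝ)) : C(K, ℝ)) =
          complexify (f₁ : C(K, ℝ)) + complexify (f₂ : C(K, ℝ)) := by
          ext x; simp [complexify]
        simp [this]
      map_smul' := by
        intro c f
        have : complexify ((c • f : C_c(K, ℝ)) : C(K, ℝ)) =
          (c : ℂ) • complexify (f : C(K, ℝ)) := by
          ext x; simp [complexify]
        rw [this, map_smul, smul_apply, inner_smul_right]
        simp }
    (by
      intro f hf
      -- Positivity: writing `f` as `star √f * √f` turns the functional into the square of `‖Φ √f
      -- g‖`.
      have : complexify (f : C(K, ℝ)) =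
          star (complexify ⟨fun x => Real.sqrt (f x), by fun_prop⟩) *
            complexify ⟨fun x => Real.sqrt (f x), by fun_prop⟩ := by
        ext x
        have h0 : 0 ≤ f x := hf x
        simp only [complexify, ContinuousMap.coe_mk, ContinuousMap.mul_apply,
          ContinuousMap.star_apply, Complex.star_def, Complex.conj_ofReal]
        rw [← Complex.ofReal_mul, Real.mul_self_sqrt h0]
      change 0 ≤ (inner ℂ g (Φ (complexify f) g)).re
      rw [this, ← inner_map_star_mul]
      exact inner_self_nonneg (𝕜 := ℂ))

/-- The measure representing `f ↦ ⟨g, Φ f g⟩`. -/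
def vectorMeasure (Φ : C(K, ℂ) →⋆ₐ[ℂ] (H →L[ℂ] H)) (g : H) : Measure K :=
  RealRMK.rieszMeasure (vectorFunctional Φ g)

instance (Φ : C(K, ℂ) →⋆ₐ[ℂ] (H →L[ℂ] H)) (g : H) : IsFiniteMeasure (vectorMeasure Φ g) := by
  unfold vectorMeasure; infer_instance

theorem integral_vectorMeasure_real (Φ : C(K, ℂ) →⋆ₐ[ℂ] (H →L[ℂ] H)) (g : H) (f : C(K, ℝ)) :
    ∫ x, ((f x : ℝ) : ℂ) ∂(vectorMeasure Φ g) = inner ℂ g (Φ (complexify f) g) := by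
  have h := RealRMK.integral_rieszMeasure (vectorFunctional Φ g)
    ⟨f, HasCompactSupport.of_compactSpace _⟩
  rw [integral_complex_ofReal, ← inner_map_complexify]
  exact congrArg _ h

theorem integral_vectorMeasure (Φ : C(K, ℂ) →⋆ₐ[ℂ] (H →L[ℂ] H)) (g : H) (f : C(K, ℂ)) :
    ∫ x, f x ∂(vectorMeasure Φ g) = inner ℂ g (Φ f g) := by
  set f₁ : C(K, ℝ) := ⟨fun x => (f x).re, by fun_prop⟩
  set f₂ : C(K, ℝ) := ⟨fun x => (f x).im, by fun_prop⟩
  have hf : f = complexify f₁ + Complex.I • complexify f₂ := by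
    ext x
    simp [complexify, f₁, f₂, mul_comm Complex.I, Complex.re_add_im]
  have hi : ∀ u : C(K, ℝ), Integrable (fun x => ((u x : ℝ) : ℂ)) (vectorMeasure Φ g) := fun u =>
    (complexify u).continuous.integrable_of_hasCompactSupport (HasCompactSupport.of_compactSpace _)
  conv_rhs => rw [hf]
  rw [map_add, map_smul, add_apply, smul_apply,
    inner_add_right, inner_smul_right, ← integral_vectorMeasure_real,
    ← integral_vectorMeasure_real, ← integral_const_mul, ← integral_add (hi _) ((hi _).const_mul _)]
  refine integral_congr_ae (Eventually.of_forall fun x => ?_)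
  simp [f₁, f₂, mul_comm Complex.I, Complex.re_add_im]

/-- The representing measure is made so that the orbit map is isometric for its `L²` norm; this is
what permits passing from continuous to square-integrable functions. -/
theorem inner_toLp_vectorMeasure (Φ : C(K, ℂ) →⋆ₐ[ℂ] (H →L[ℂ] H)) (g : H) (f₁ f₂ : C(K, ℂ)) :
    inner ℂ (ContinuousMap.toLp 2 (vectorMeasure Φ g) ℂ f₁)
      (ContinuousMap.toLp 2 (vectorMeasure Φ g) ℂ f₂) = inner ℂ (Φ f₁ g) (Φ f₂ g) := by
  rw [inner_map_star_mul, ← integral_vectorMeasure, ContinuousMap.inner_toLp]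
  simp [mul_comm]

theorem norm_toLp_vectorMeasure (Φ : C(K, ℂ) →⋆ₐ[ℂ] (H →L[ℂ] H)) (g : H) (f : C(K, ℂ)) :
    ‖Φ f g‖ = ‖ContinuousMap.toLp 2 (vectorMeasure Φ g) ℂ f‖ := by
  rw [@norm_eq_sqrt_re_inner ℂ, @norm_eq_sqrt_re_inner ℂ, inner_toLp_vectorMeasure]

/-- The map `f ↦ Φ f g` on continuous functions. -/
def orbitMap (Φ : C(K, ℂ) →⋆ₐ[ℂ] (H →L[ℂ] H)) (g : H) : C(K, ℂ) →ₗ[ℂ] H where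
  toFun f := Φ f g
  map_add' f₁ f₂ := by rw [map_add, add_apply]
  map_smul' c f := by rw [map_smul, smul_apply, RingHom.id_apply]

/-- The map `f ↦ Φ f g`, extended from continuous to square-integrable functions. -/
def cyclicMap (Φ : C(K, ℂ) →⋆ₐ[ℂ] (H →L[ℂ] H)) (g : H) :
    Lp ℂ 2 (vectorMeasure Φ g) →L[ℂ] H :=
  -- The dense range and the norm bound that make this a genuine extension are supplied in
  -- `cyclicMap_toLp`.
  LinearMap.extendOfNorm (orbitMap Φ g)
    (ContinuousMap.toLp 2 (vectorMeasure Φ g) ℂ : C(K, ℂ) →L[ℂ] _).toLinearMap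

theorem cyclicMap_toLp (Φ : C(K, ℂ) →⋆ₐ[ℂ] (H →L[ℂ] H)) (g : H) (f : C(K, ℂ)) :
    cyclicMap Φ g (ContinuousMap.toLp 2 (vectorMeasure Φ g) ℂ f) = Φ f g := by
  have h := LinearMap.extendOfNorm_eq (f := orbitMap Φ g)
    (e := (ContinuousMap.toLp 2 (vectorMeasure Φ g) ℂ : C(K, ℂ) →L[ℂ] _).toLinearMap)
    (ContinuousMap.toLp_denseRange ℂ _ ℂ (by simp))
    ⟨1, fun f => by rw [one_mul]; exact (norm_toLp_vectorMeasure Φ g f).le⟩ f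
  exact h

theorem inner_cyclicMap (Φ : C(K, ℂ) →⋆ₐ[ℂ] (H →L[ℂ] H)) (g : H)
    (F₁ F₂ : Lp ℂ 2 (vectorMeasure Φ g)) :
    inner ℂ (cyclicMap Φ g F₁) (cyclicMap Φ g F₂) = inner ℂ F₁ F₂ := by
  have hd : DenseRange (ContinuousMap.toLp 2 (vectorMeasure Φ g) ℂ : C(K, ℂ) →L[ℂ] _) :=
    ContinuousMap.toLp_denseRange ℂ _ ℂ (by simp)
  refine hd.induction_on₂ (p := fun F₁ F₂ =>
    inner ℂ (cyclicMap Φ g F₁) (cyclicMap Φ g F₂) = inner ℂ F₁ F₂) ?_ ?_ F₁ F₂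
  · exact isClosed_eq (by fun_prop) (by fun_prop)
  · intro f₁ f₂
    rw [cyclicMap_toLp, cyclicMap_toLp, inner_toLp_vectorMeasure]

theorem norm_cyclicMap (Φ : C(K, ℂ) →⋆ₐ[ℂ] (H →L[ℂ] H)) (g : H)
    (F : Lp ℂ 2 (vectorMeasure Φ g)) : ‖cyclicMap Φ g F‖ = ‖F‖ := by
  rw [@norm_eq_sqrt_re_inner ℂ, @norm_eq_sqrt_re_inner ℂ, inner_cyclicMap]

open scoped Classical in
/-- The value on `g` of the spectral projection belonging to a set `D`. -/
def spectralValue (Φ : C(K, ℂ) →⋆ₐ[ℂ] (H →L[ℂ] H)) (D : Set K) (g : H) : H :=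
  if hD : MeasurableSet D then
    cyclicMap Φ g (indicatorConstLp 2 hD (measure_ne_top (vectorMeasure Φ g) D) (1 : ℂ))
  else 0

theorem spectralValue_of_measurableSet (Φ : C(K, ℂ) →⋆ₐ[ℂ] (H →L[ℂ] H)) {D : Set K}
    (hD : MeasurableSet D) (g : H) : spectralValue Φ D g =
    cyclicMap Φ g (indicatorConstLp 2 hD (measure_ne_top (vectorMeasure Φ g) D) (1 : ℂ)) := by
  rw [spectralValue, dif_pos hD]

/-- The cyclic map is isometric, so this is an inner product of two indicators. The norm bound,
self-adjointness, multiplicativity and countable additivity of the projections all rest on it. -/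
theorem inner_spectralValue (Φ : C(K, ℂ) →⋆ₐ[ℂ] (H →L[ℂ] H)) {D₁ D₂ : Set K}
    (h₁ : MeasurableSet D₁) (h₂ : MeasurableSet D₂) (g : H) :
    inner ℂ (spectralValue Φ D₁ g) (spectralValue Φ D₂ g) =
      ((vectorMeasure Φ g).real (D₁ ∩ D₂) : ℂ) := by
  rw [spectralValue_of_measurableSet Φ h₁, spectralValue_of_measurableSet Φ h₂, inner_cyclicMap,
    L2.inner_indicatorConstLp_one]
  rw [setIntegral_congr_ae (g := D₂.indicator fun _ => (1 : ℂ)) h₁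
    (indicatorConstLp_coeFn.mono fun x hx _ => hx), integral_indicator h₂, integral_const]
  simp [Measure.real, Measure.restrict_apply, Set.inter_comm, h₂]

theorem spectralValue_univ (Φ : C(K, ℂ) →⋆ₐ[ℂ] (H →L[ℂ] H)) (g : H) :
    spectralValue Φ Set.univ g = g := by
  have h : indicatorConstLp 2 MeasurableSet.univ (measure_ne_top (vectorMeasure Φ g) Set.univ)
      (1 : ℂ) = ContinuousMap.toLp 2 (vectorMeasure Φ g) ℂ 1 := by
    apply Lp.ext
    filter_upwards [indicatorConstLp_coeFn (p := 2) (hs := MeasurableSet.univ)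
      (hμs := measure_ne_top (vectorMeasure Φ g) Set.univ) (c := (1 : ℂ)),
      ContinuousMap.coeFn_toLp (p := 2) (𝕜 := ℂ) (vectorMeasure Φ g) (1 : C(K, ℂ))] with x h1 h2
    rw [h1, h2]; simp
  rw [spectralValue_of_measurableSet Φ MeasurableSet.univ, h, cyclicMap_toLp]
  simp

theorem spectralValue_union (Φ : C(K, ℂ) →⋆ₐ[ℂ] (H →L[ℂ] H)) {D₁ D₂ : Set K}
    (h₁ : MeasurableSet D₁) (h₂ : MeasurableSet D₂) (hd : Disjoint D₁ D₂) (g : H) :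
    spectralValue Φ (D₁ ∪ D₂) g = spectralValue Φ D₁ g + spectralValue Φ D₂ g := by
  rw [spectralValue_of_measurableSet Φ h₁, spectralValue_of_measurableSet Φ h₂,
    spectralValue_of_measurableSet Φ (h₁.union h₂), indicatorConstLp_disjoint_union h₁ h₂ _ _ hd,
    map_add]

/-- Continuous functions close to an indicator function in mean square, for a finite measure. -/
theorem exists_continuousMap_eLpNorm_sub_indicator_le (m : Measure K) [IsFiniteMeasure m]
    {D : Set K} (hD : MeasurableSet D) {ε : ℝ} (hε : 0 < ε) :
    ∃ f : C(K, ℂ), eLpNorm (fun x => f x - D.indicator (fun _ => (1 : ℂ)) x) 2 m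
      ≤ ENNReal.ofReal ε := by
  have hm : MemLp (D.indicator fun _ => (1 : ℂ)) 2 m :=
    memLp_indicator_const 2 hD 1 (Or.inr (measure_ne_top m D))
  obtain ⟨f, hf, -⟩ := hm.exists_boundedContinuous_eLpNorm_sub_le (by simp)
    (ε := ENNReal.ofReal ε) (by simpa using hε)
  refine ⟨f.toContinuousMap, ?_⟩
  rw [← eLpNorm_neg]
  convert hf using 2
  ext x
  simp

/-- The dominating measure `m` allows one continuous `f` to serve several vectors at once. -/
theorem norm_map_sub_spectralValue_le (Φ : C(K, ℂ) →⋆ₐ[ℂ] (H →L[ℂ] H)) {D : Set K}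
    (hD : MeasurableSet D) (g : H) (f : C(K, ℂ)) {m : Measure K} (hm : vectorMeasure Φ g ≤ m)
    {ε : ℝ} (hε : 0 ≤ ε)
    (hf : eLpNorm (fun x => f x - D.indicator (fun _ => (1 : ℂ)) x) 2 m ≤ ENNReal.ofReal ε) :
    ‖Φ f g - spectralValue Φ D g‖ ≤ ε := by
  rw [spectralValue_of_measurableSet Φ hD, ← cyclicMap_toLp, ← map_sub, norm_cyclicMap,
    Lp.norm_def]
  refine ENNReal.toReal_le_of_le_ofReal hε (le_trans (le_of_eq ?_) ((eLpNorm_mono_measure _ hm).trans hf))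
  apply eLpNorm_congr_ae
  filter_upwards [Lp.coeFn_sub (ContinuousMap.toLp 2 (vectorMeasure Φ g) ℂ f)
      (indicatorConstLp 2 hD (measure_ne_top (vectorMeasure Φ g) D) (1 : ℂ)),
    indicatorConstLp_coeFn (p := 2) (hs := hD)
      (hμs := measure_ne_top (vectorMeasure Φ g) D) (c := (1 : ℂ)),
    ContinuousMap.coeFn_toLp (p := 2) (𝕜 := ℂ) (vectorMeasure Φ g) f] with x h1 h2 h3
  rw [h1, Pi.sub_apply, h2, h3]

/-- Linearity is not immediate, since each vector has its own measure and its own cyclic map. A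
single continuous `f` near the indicator in `L²` of the sum of the three measures compares all three
values with the linear operator `Φ f`. -/
theorem spectralValue_add_smul (Φ : C(K, ℂ) →⋆ₐ[ℂ] (H →L[ℂ] H)) {D : Set K}
    (hD : MeasurableSet D) (c : ℂ) (g h : H) :
    spectralValue Φ D (g + c • h) = spectralValue Φ D g + c • spectralValue Φ D h := by
  set m := vectorMeasure Φ g + vectorMeasure Φ h + vectorMeasure Φ (g + c • h)
  rw [← sub_eq_zero, ← norm_eq_zero]
  refine le_antisymm (le_of_forall_pos_le_add fun δ hδ => ?_) (norm_nonneg _)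
  -- The three errors add up to `ε + ‖c‖ * ε + ε`.
  set ε := δ / (2 + ‖c‖)
  have hc : 0 < 2 + ‖c‖ := by positivity
  have hε : 0 < ε := by positivity
  obtain ⟨f, hf⟩ := exists_continuousMap_eLpNorm_sub_indicator_le m hD hε
  have h1 := norm_map_sub_spectralValue_le Φ hD g f
    (m := m) ((Measure.le_add_right le_rfl).trans (Measure.le_add_right le_rfl)) hε.le hf
  have h2 := norm_map_sub_spectralValue_le Φ hD h f
    (m := m) ((Measure.le_add_left le_rfl).trans (Measure.le_add_right le_rfl)) hε.le hf
  have h3 := norm_map_sub_spectralValue_le Φ hD (g + c • h) f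
    (m := m) (Measure.le_add_left le_rfl) hε.le hf
  have e : spectralValue Φ D (g + c • h) - (spectralValue Φ D g + c • spectralValue Φ D h) =
      (Φ f g - spectralValue Φ D g) + c • (Φ f h - spectralValue Φ D h) -
        (Φ f (g + c • h) - spectralValue Φ D (g + c • h)) := by
    rw [map_add, map_smul, smul_sub]; abel
  rw [e]
  calc _ ≤ ‖Φ f g - spectralValue Φ D g‖ + ‖c‖ * ‖Φ f h - spectralValue Φ D h‖ +
        ‖Φ f (g + c • h) - spectralValue Φ D (g + c • h)‖ := by
        refine (norm_sub_le _ _).trans (add_le_add_left ((norm_add_le _ _).trans ?_) _)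
        rw [norm_smul]
    _ ≤ ε + ‖c‖ * ε + ε := by gcongr
    _ = 0 + δ := by simp only [ε]; field_simp; ring

theorem vectorMeasure_real_univ (Φ : C(K, ℂ) →⋆ₐ[ℂ] (H →L[ℂ] H)) (g : H) :
    (vectorMeasure Φ g).real Set.univ = ‖g‖ ^ 2 := by
  have h := inner_spectralValue Φ MeasurableSet.univ MeasurableSet.univ g
  rw [spectralValue_univ, Set.univ_inter] at h
  rw [norm_sq_eq_re_inner (𝕜 := ℂ), h]
  simp

theorem norm_spectralValue_sq (Φ : C(K, ℂ) →⋆ₐ[ℂ] (H →L[ℂ] H)) {D : Set K}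
    (hD : MeasurableSet D) (g : H) :
    ‖spectralValue Φ D g‖ ^ 2 = (vectorMeasure Φ g).real D := by
  rw [norm_sq_eq_re_inner (𝕜 := ℂ), inner_spectralValue Φ hD hD, Set.inter_self]
  simp

theorem norm_spectralValue_le (Φ : C(K, ℂ) →⋆ₐ[ℂ] (H →L[ℂ] H)) {D : Set K}
    (hD : MeasurableSet D) (g : H) : ‖spectralValue Φ D g‖ ≤ ‖g‖ := by
  refine le_of_sq_le_sq ?_ (norm_nonneg _)
  rw [norm_spectralValue_sq Φ hD, ← vectorMeasure_real_univ Φ]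
  exact measureReal_mono (Set.subset_univ _)

open scoped Classical in
/-- The spectral projection belonging to a set `D`. -/
def spectralProj (Φ : C(K, ℂ) →⋆ₐ[ℂ] (H →L[ℂ] H)) (D : Set K) : H →L[ℂ] H :=
  if hD : MeasurableSet D then
    LinearMap.mkContinuous
      { toFun := spectralValue Φ D
        map_add' := fun g h => by simpa using spectralValue_add_smul Φ hD 1 g h
        map_smul' := fun c h => by
          have h0 : spectralValue Φ D 0 = 0 := by
            simpa using norm_spectralValue_le Φ hD (0 : H)
          simpa [h0] using spectralValue_add_smul Φ hD c 0 h } 1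
      (fun g => by simpa using norm_spectralValue_le Φ hD g)
  else 0

theorem spectralProj_apply (Φ : C(K, ℂ) →⋆ₐ[ℂ] (H →L[ℂ] H)) {D : Set K}
    (hD : MeasurableSet D) (g : H) : spectralProj Φ D g = spectralValue Φ D g := by
  rw [spectralProj, dif_pos hD]; rfl

theorem inner_spectralProj_right (Φ : C(K, ℂ) →⋆ₐ[ℂ] (H →L[ℂ] H)) {D : Set K}
    (hD : MeasurableSet D) (g : H) :
    inner ℂ g (spectralProj Φ D g) = ((vectorMeasure Φ g).real D : ℂ) := by
  have h := inner_spectralValue Φ MeasurableSet.univ hD g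
  rwa [spectralValue_univ, Set.univ_inter, ← spectralProj_apply Φ hD] at h

theorem inner_spectralProj_left (Φ : C(K, ℂ) →⋆ₐ[ℂ] (H →L[ℂ] H)) {D : Set K}
    (hD : MeasurableSet D) (g : H) :
    inner ℂ (spectralProj Φ D g) g = ((vectorMeasure Φ g).real D : ℂ) := by
  rw [← inner_conj_symm, inner_spectralProj_right Φ hD, Complex.conj_ofReal]

theorem isSelfAdjoint_spectralProj (Φ : C(K, ℂ) →⋆ₐ[ℂ] (H →L[ℂ] H)) {D : Set K}
    (hD : MeasurableSet D) : IsSelfAdjoint (spectralProj Φ D) := by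
  rw [ContinuousLinearMap.isSelfAdjoint_iff_isSymmetric,
    LinearMap.isSymmetric_iff_inner_map_self_real]
  intro g
  change (starRingEnd ℂ) (inner ℂ (spectralProj Φ D g) g) = inner ℂ (spectralProj Φ D g) g
  rw [inner_spectralProj_left Φ hD, Complex.conj_ofReal]

theorem inner_spectralProj_symm (Φ : C(K, ℂ) →⋆ₐ[ℂ] (H →L[ℂ] H)) {D : Set K}
    (hD : MeasurableSet D) (g h : H) :
    inner ℂ (spectralProj Φ D g) h = inner ℂ g (spectralProj Φ D h) :=
  ContinuousLinearMap.isSelfAdjoint_iff_isSymmetric.1 (isSelfAdjoint_spectralProj Φ hD) g h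

/-- Spectral projections multiply as the sets intersect. -/
theorem spectralProj_spectralProj (Φ : C(K, ℂ) →⋆ₐ[ℂ] (H →L[ℂ] H)) {D₁ D₂ : Set K}
    (h₁ : MeasurableSet D₁) (h₂ : MeasurableSet D₂) :
    spectralProj Φ D₁ ∘L spectralProj Φ D₂ = spectralProj Φ (D₁ ∩ D₂) := by
  rw [← sub_eq_zero]
  apply ContinuousLinearMap.coe_injective
  -- On a complex space an operator with vanishing quadratic form is zero, so only diagonal matrix
  -- elements need checking.
  refine (inner_map_self_eq_zero _).1 fun g => ?_
  change inner ℂ (spectralProj Φ D₁ (spectralProj Φ D₂ g) - spectralProj Φ (D₁ ∩ D₂) g) g = 0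
  rw [inner_sub_left, inner_spectralProj_symm Φ h₁, spectralProj_apply Φ h₁,
    spectralProj_apply Φ h₂, inner_spectralValue Φ h₂ h₁, inner_spectralProj_left Φ (h₁.inter h₂),
    Set.inter_comm, sub_self]

theorem spectralProj_iUnion_sub (Φ : C(K, ℂ) →⋆ₐ[ℂ] (H →L[ℂ] H)) {D : ℕ → Set K}
    (hD : ∀ k, MeasurableSet (D k)) (hdis : Pairwise fun i j => Disjoint (D i) (D j)) (g : H)
    (m : ℕ) : ∑ k ∈ Finset.range m, spectralProj Φ (D k) g =
      spectralProj Φ (⋃ k ∈ Finset.range m, D k) g := by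
  induction m with
  | zero =>
    have h := norm_spectralValue_sq Φ MeasurableSet.empty g
    rw [measureReal_empty] at h
    simp only [Finset.range_zero, Finset.sum_empty, Finset.notMem_empty, Set.iUnion_of_empty,
      Set.iUnion_empty]
    rw [spectralProj_apply Φ MeasurableSet.empty]
    exact (norm_eq_zero.1 (pow_eq_zero_iff two_ne_zero |>.1 h)).symm
  | succ m ih =>
    have hU : MeasurableSet (⋃ k ∈ Finset.range m, D k) :=
      Finset.measurableSet_biUnion _ fun k _ => hD k
    rw [Finset.sum_range_succ, ih, Finset.range_add_one, Finset.set_biUnion_insert, Set.union_comm,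
      spectralProj_apply Φ hU, spectralProj_apply Φ (hD m), spectralProj_apply Φ (hU.union (hD m)),
      spectralValue_union Φ hU (hD m)]
    rw [Set.disjoint_iUnion₂_left]
    intro k hk
    exact hdis (Finset.mem_range.1 hk).ne

/-- The squared distance from a partial sum to the limit is the `vectorMeasure` of the part of the
union not yet covered, which tends to zero by continuity from below. -/
theorem tendsto_sum_spectralProj (Φ : C(K, ℂ) →⋆ₐ[ℂ] (H →L[ℂ] H)) {D : ℕ → Set K}
    (hD : ∀ k, MeasurableSet (D k)) (hdis : Pairwise fun i j => Disjoint (D i) (D j)) (g : H) :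
    Tendsto (fun m => ∑ k ∈ Finset.range m, spectralProj Φ (D k) g) atTop
      (𝓝 (spectralProj Φ (⋃ k, D k) g)) := by
  set U : ℕ → Set K := fun m => ⋃ k ∈ Finset.range m, D k
  have hU : ∀ m, MeasurableSet (U m) := fun m => Finset.measurableSet_biUnion _ fun k _ => hD k
  have hA : MeasurableSet (⋃ k, D k) := MeasurableSet.iUnion hD
  have hsub : ∀ m, U m ⊆ ⋃ k, D k := fun m => Set.iUnion₂_subset fun k _ => Set.subset_iUnion D k
  have hmono : Monotone U := fun a b hab => Set.biUnion_subset_biUnion_left fun k hk =>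
    Finset.mem_coe.2 (Finset.range_mono hab hk)
  have hUn : ⋃ m, U m = ⋃ k, D k := by
    refine Set.Subset.antisymm (Set.iUnion_subset hsub) (Set.iUnion_subset fun k => ?_)
    exact Set.Subset.trans (Set.subset_biUnion_of_mem (u := D)
      (Finset.mem_coe.2 (Finset.self_mem_range_succ k))) (Set.subset_iUnion U (k + 1))
  simp_rw [spectralProj_iUnion_sub Φ hD hdis]
  rw [tendsto_iff_norm_sub_tendsto_zero]
  have hsq : ∀ m, ‖spectralProj Φ (U m) g - spectralProj Φ (⋃ k, D k) g‖ ^ 2 =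
      (vectorMeasure Φ g).real (⋃ k, D k) - (vectorMeasure Φ g).real (U m) := by
    intro m
    have hd := spectralValue_union Φ (hU m) (hA.diff (hU m)) Set.disjoint_sdiff_right g
    rw [Set.union_sdiff_cancel (hsub m)] at hd
    rw [spectralProj_apply Φ (hU m), spectralProj_apply Φ hA, hd, sub_add_cancel_left, norm_neg,
      norm_spectralValue_sq Φ (hA.diff (hU m)), measureReal_sdiff (hsub m) (hU m)]
  have ht : Tendsto (fun m => (vectorMeasure Φ g).real (U m)) atTop
      (𝓝 ((vectorMeasure Φ g).real (⋃ k, D k))) := by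
    rw [← hUn]
    exact (ENNReal.tendsto_toReal (measure_ne_top _ _)).comp (tendsto_measure_iUnion_atTop hmono)
  have h2 : Tendsto (fun m => ‖spectralProj Φ (U m) g - spectralProj Φ (⋃ k, D k) g‖ ^ 2) atTop
      (𝓝 0) := by
    simp_rw [hsq]
    simpa using ht.const_sub ((vectorMeasure Φ g).real (⋃ k, D k))
  have h3 := (Real.continuous_sqrt.tendsto _).comp h2
  simpa only [Function.comp_def, Real.sqrt_sq (norm_nonneg _), Real.sqrt_zero] using h3

/-- The projection-valued measure of a representation of the continuous functions, carried over to
a measurable space `Ω` along a measurable map. -/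
def spectralPVM {Ω : Type*} [MeasurableSpace Ω] (Φ : C(K, ℂ) →⋆ₐ[ℂ] (H →L[ℂ] H)) {τ : K → Ω}
    (hτ : Measurable τ) : ProjectionValuedMeasure Ω H where
  proj D := spectralProj Φ (τ ⁻¹' D)
  isStarProjection D hD :=
    ⟨by
      have := spectralProj_spectralProj Φ (hτ hD) (hτ hD)
      rwa [Set.inter_self] at this, isSelfAdjoint_spectralProj Φ (hτ hD)⟩
  proj_empty := by
    ext g
    have h := norm_spectralValue_sq Φ MeasurableSet.empty g
    rw [measureReal_empty] at h
    rw [Set.preimage_empty, spectralProj_apply Φ MeasurableSet.empty]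
    exact norm_eq_zero.1 (pow_eq_zero_iff two_ne_zero |>.1 h)
  proj_univ := by
    ext g
    rw [Set.preimage_univ, spectralProj_apply Φ MeasurableSet.univ, spectralValue_univ]
    rfl
  orthogonal D₁ D₂ h₁ h₂ hd g h := by
    have e := spectralProj_spectralProj Φ (hτ h₁) (hτ h₂)
    rw [← Set.preimage_inter, hd.inter_eq, Set.preimage_empty] at e
    have e2 := congrArg (fun A : H →L[ℂ] H => A h) e
    have h0 := norm_spectralValue_sq Φ MeasurableSet.empty h
    rw [measureReal_empty] at h0
    simp only [ContinuousLinearMap.comp_apply] at e2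
    rw [inner_spectralProj_symm Φ (hτ h₁), e2, spectralProj_apply Φ MeasurableSet.empty,
      norm_eq_zero.1 (pow_eq_zero_iff two_ne_zero |>.1 h0), inner_zero_right]
  tendsto_iUnion D hD hdis g := by
    rw [Set.preimage_iUnion]
    exact tendsto_sum_spectralProj Φ (fun k => hτ (hD k))
      (fun i j hij => (hdis hij).preimage τ) g

theorem scalarMeasure_spectralPVM {Ω : Type*} [MeasurableSpace Ω]
    (Φ : C(K, ℂ) →⋆ₐ[ℂ] (H →L[ℂ] H)) {τ : K → Ω} (hτ : Measurable τ) (g : H) :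
    (spectralPVM Φ hτ).scalarMeasure g = (vectorMeasure Φ g).map τ := by
  ext D hD
  rw [ProjectionValuedMeasure.scalarMeasure_apply _ _ hD, Measure.map_apply hτ hD]
  change ENNReal.ofReal (inner ℂ (spectralProj Φ (τ ⁻¹' D) g) g).re = _
  rw [inner_spectralProj_left Φ (hτ hD), Complex.ofReal_re, ofReal_measureReal]

end SpectralTheorem

/-! ### The spectral theorem for unitary operators. -/

section UnitarySpectralTheorem

variable {H : Type*} [NormedAddCommGroup H] [InnerProductSpace ℂ H] [CompleteSpace H]

/-- The argument of a complex number in `[-π, π)`. -/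
def phase (z : ℂ) : Phase :=
  if h : z.arg < Real.pi then ⟨z.arg, (Complex.neg_pi_lt_arg z).le, h⟩
  -- `Complex.arg` takes values in `(-π, π]`; the value `π` is moved to `-π`.
  else ⟨-Real.pi, le_rfl, by linarith [Real.pi_pos]⟩

theorem measurable_phase : Measurable phase := by
  have : Measurable fun z : ℂ => ((phase z : Phase) : ℝ) := by
    have e : (fun z : ℂ => ((phase z : Phase) : ℝ)) =
        fun z => if z.arg < Real.pi then z.arg else -Real.pi := by
      funext z; unfold phase; split_ifs <;> rfl
    rw [e]
    exact Measurable.ite (measurableSet_lt Complex.measurable_arg measurable_const)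
      Complex.measurable_arg measurable_const
  exact this.subtype_mk

theorem exp_phase {z : ℂ} (hz : ‖z‖ = 1) : Complex.exp (Complex.I * ((phase z : ℝ) : ℂ)) = z := by
  have h := Complex.norm_mul_exp_arg_mul_I z
  rw [hz, Complex.ofReal_one, one_mul, mul_comm] at h
  unfold phase
  split_ifs with h1
  · exact h
  · have h2 : z.arg = Real.pi := le_antisymm (Complex.arg_le_pi z) (not_lt.1 h1)
    rw [h2, mul_comm, Complex.exp_pi_mul_I] at h
    rw [← h]
    simp [mul_comm Complex.I, Complex.exp_neg, Complex.exp_pi_mul_I]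

theorem mem_unitary_toContinuousLinearMap (U : H ≃ₗᵢ[ℂ] H) :
    (U.toContinuousLinearEquiv : H →L[ℂ] H) ∈ unitary (H →L[ℂ] H) := by
  rw [Unitary.mem_iff]
  constructor <;> ext x
  · refine ext_inner_left ℂ fun y => ?_
    rw [mul_apply_eq_comp, ContinuousLinearMap.star_eq_adjoint,
      ContinuousLinearMap.adjoint_inner_right]
    exact U.inner_map_map y x
  · obtain ⟨z, rfl⟩ := U.surjective x
    rw [mul_apply_eq_comp, ContinuousLinearMap.star_eq_adjoint]
    change U (ContinuousLinearMap.adjoint _ (U z)) = U z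
    congr 1
    refine ext_inner_left ℂ fun y => ?_
    rw [ContinuousLinearMap.adjoint_inner_right]
    exact U.inner_map_map y z

theorem pow_toContinuousLinearMap_apply (U : H ≃ₗᵢ[ℂ] H) (k : ℕ) (g : H) :
    ((U.toContinuousLinearEquiv : H →L[ℂ] H) ^ k) g = (U ^ k) g := by
  induction k with
  | zero => rfl
  | succ k ih => rw [pow_succ', mul_apply_eq_comp, ih, pow_succ']; rfl

/-- A projection-valued measure is the spectral resolution of `U` as soon as it represents the
non-negative powers of `U`. -/
theorem isSpectralResolution_of_nat (U : H ≃ₗᵢ[ℂ] H) (S : ProjectionValuedMeasure Phase H)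
    (h : ∀ (k : ℕ) (g : H), inner ℂ g ((U ^ k) g) =
      ∫ θ : Phase, Complex.exp (Complex.I * ((θ : ℝ) : ℂ) * (k : ℂ)) ∂(S.scalarMeasure g)) :
    IsSpectralResolution U S := by
  intro k g
  obtain ⟨m, rfl | rfl⟩ := k.eq_nat_or_neg
  · simpa using h m g
  -- Since `U` is unitary, a negative power gives the conjugate correlation, matching the conjugate
  -- of the integral against a positive measure.
  · have e : inner ℂ g ((U ^ (-(m : ℤ))) g) = (starRingEnd ℂ) (inner ℂ g ((U ^ m) g)) := by
      rw [inner_conj_symm, ← (U ^ m).inner_map_map g]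
      congr 1
      change (U ^ m * U ^ (-(m : ℤ))) g = g
      rw [← zpow_natCast, ← zpow_add, add_neg_cancel, zpow_zero]
      rfl
    rw [e, h, ← integral_conj]
    refine integral_congr_ae (Eventually.of_forall fun θ => ?_)
    simp [← Complex.exp_conj]

/-- The spectral theorem for unitary operators. -/
theorem exists_isSpectralResolution (U : H ≃ₗᵢ[ℂ] H) :
    ∃ S : ProjectionValuedMeasure Phase H, IsSpectralResolution U S := by
  set a : H →L[ℂ] H := (U.toContinuousLinearEquiv : H →L[ℂ] H) with ha
  have hu : a ∈ unitary (H →L[ℂ] H) := mem_unitary_toContinuousLinearMap U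
  have hn : IsStarNormal a := ⟨by
    rw [Commute, SemiconjBy, (Unitary.mem_iff.1 hu).1, (Unitary.mem_iff.1 hu).2]⟩
  set Φ : C(spectrum ℂ a, ℂ) →⋆ₐ[ℂ] (H →L[ℂ] H) := cfcHom (R := ℂ) hn with hΦ
  have hτ : Measurable fun z : spectrum ℂ a => phase z :=
    measurable_phase.comp measurable_subtype_coe
  have hK : ∀ z : spectrum ℂ a, ‖(z : ℂ)‖ = 1 := fun z => by
    simpa using spectrum.subset_circle_of_unitary hu z.2
  refine ⟨spectralPVM Φ hτ, isSpectralResolution_of_nat U _ fun k g => ?_⟩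
  -- The coordinate function represents `a`. The spectrum lies on the unit circle, so `ι` is also
  -- the exponential of the phase.
  set ι : C(spectrum ℂ a, ℂ) := ContinuousMap.restrict (spectrum ℂ a) (ContinuousMap.id ℂ)
  have hι : Φ (ι ^ k) = a ^ k := by rw [map_pow, hΦ, cfcHom_id]
  rw [scalarMeasure_spectralPVM, integral_map hτ.aemeasurable, ← pow_toContinuousLinearMap_apply,
    ← ha, ← hι, ← integral_vectorMeasure]
  · refine integral_congr_ae (Eventually.of_forall fun z => ?_)
    have : Complex.exp (Complex.I * ((phase z : ℝ) : ℂ) * (k : ℂ)) = (z : ℂ) ^ k := by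
      rw [mul_comm _ (k : ℂ), Complex.exp_nat_mul, exp_phase (hK z)]
    simp only [this]
    rfl
  · exact (by fun_prop : Measurable fun θ : Phase =>
      Complex.exp (Complex.I * ((θ : ℝ) : ℂ) * (k : ℂ))).aestronglyMeasurable

end UnitarySpectralTheorem

/-! ### Step functions, averaging and the discrete Koopman operator. -/

namespace PartitionSequence

section Discretization

variable {X : Type*} [MetricSpace X] [MeasurableSpace X] [BorelSpace X] {μ : Measure X}

theorem q_pos (P : PartitionSequence μ) (hμ : μ Set.univ ≠ 0) (n : ℕ) : 0 < P.q n := by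
  rcases Nat.eq_zero_or_pos (P.q n) with h | h
  · have : IsEmpty (Fin (P.q n)) := by rw [h]; infer_instance
    exact absurd (by rw [← P.iUnion_eq n, Set.iUnion_of_empty, measure_empty]) hμ
  · exact h

variable [IsFiniteMeasure μ]

/-- Almost every point belongs to exactly one element of the partition. -/
theorem ae_existsUnique_mem (P : PartitionSequence μ) (n : ℕ) :
    ∀ᵐ x ∂μ, ∃! j, x ∈ P.p n j := by
  by_cases hμ : μ Set.univ = 0
  · exact measure_mono_null (Set.subset_univ _) hμ
  have hq := P.q_pos hμ n
  -- The number of cells containing `x` is at least 1 everywhere and has integral `μ(X)`, hence is 1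
  -- almost everywhere.
  set F : X → ENNReal := fun x => ∑ j, (P.p n j).indicator 1 x
  have hF : ∫⁻ x, F x ∂μ = μ Set.univ := by
    rw [lintegral_finsetSum _ fun j _ =>
      (measurable_one.indicator (P.isCompact n j).measurableSet)]
    simp_rw [lintegral_indicator_one (P.isCompact n _).measurableSet, P.measure_eq]
    rw [Finset.sum_const, Finset.card_univ, Fintype.card_fin, nsmul_eq_mul,
      ENNReal.mul_div_cancel (by simpa using hq.ne') (by simp)]
  have hF1 : ∀ x, 1 ≤ F x := by
    intro x
    have hx : x ∈ ⋃ j, P.p n j := by rw [P.iUnion_eq]; trivial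
    obtain ⟨j, hj⟩ := Set.mem_iUnion.1 hx
    calc (1 : ENNReal) = (P.p n j).indicator 1 x := by rw [Set.indicator_of_mem hj]; rfl
      _ ≤ F x := Finset.single_le_sum (f := fun j => (P.p n j).indicator (1 : X → ENNReal) x)
        (fun _ _ => bot_le) (Finset.mem_univ j)
  have hae : (fun _ => (1 : ENNReal)) =ᵐ[μ] F := by
    refine ae_eq_of_ae_le_of_lintegral_le (Eventually.of_forall hF1) (by simp) ?_ (by simp [hF])
    exact (Finset.measurable_sum _ fun j _ =>
      measurable_one.indicator (P.isCompact n j).measurableSet).aemeasurable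
  filter_upwards [hae] with x hx
  have hxU : x ∈ ⋃ j, P.p n j := by rw [P.iUnion_eq]; trivial
  obtain ⟨j, hj⟩ := Set.mem_iUnion.1 hxU
  refine ⟨j, hj, fun i hi => ?_⟩
  by_contra hij
  have h2 : (P.p n i).indicator 1 x + (P.p n j).indicator 1 x ≤ F x := by
    rw [← Finset.sum_pair (f := fun j => (P.p n j).indicator (1 : X → ENNReal) x) hij]
    exact Finset.sum_le_sum_of_subset (Finset.subset_univ _)
  rw [← hx, Set.indicator_of_mem hi, Set.indicator_of_mem hj, Pi.one_apply, one_add_one_eq_two]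
    at h2
  exact absurd h2 (by norm_num)

theorem measure_inter (P : PartitionSequence μ) (n : ℕ) {i j : Fin (P.q n)} (hij : i ≠ j) :
    μ (P.p n i ∩ P.p n j) = 0 := by
  refine measure_mono_null ?_ (ae_iff.1 (P.ae_existsUnique_mem n))
  intro x hx h
  exact hij (h.unique hx.1 hx.2)

theorem measureReal_eq (P : PartitionSequence μ) (n : ℕ) (j : Fin (P.q n)) :
    μ.real (P.p n j) = μ.real Set.univ / P.q n := by
  rw [Measure.real, P.measure_eq, ENNReal.toReal_div]; simp [Measure.real]

theorem inner_indicator (P : PartitionSequence μ) (n : ℕ) (i j : Fin (P.q n)) :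
    inner ℂ (P.indicator n i) (P.indicator n j) =
      if i = j then ((μ.real Set.univ / P.q n : ℝ) : ℂ) else 0 := by
  have hm : ∀ j, MeasurableSet (P.p n j) := fun j => (P.isCompact n j).measurableSet
  have h : inner ℂ (P.indicator n i) (P.indicator n j) = (μ.real (P.p n i ∩ P.p n j) : ℂ) := by
    unfold indicator
    rw [L2.inner_indicatorConstLp_one, setIntegral_congr_ae
      (g := (P.p n j).indicator fun _ => (1 : ℂ)) (hm i)
      (indicatorConstLp_coeFn.mono fun x hx _ => hx), integral_indicator (hm j), integral_const]
    simp [Measure.real, Measure.restrict_apply, Set.inter_comm, hm]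
  rw [h]
  split_ifs with hij
  · rw [hij, Set.inter_self, P.measureReal_eq]
  · rw [Measure.real, P.measure_inter n hij]; simp

theorem average_eq_inner (P : PartitionSequence μ) (n : ℕ) (g : Lp ℂ 2 μ) (j : Fin (P.q n)) :
    P.average n g j = ((P.q n / μ.real Set.univ : ℝ) : ℂ) * inner ℂ (P.indicator n j) g := by
  unfold average indicator
  rw [L2.inner_indicatorConstLp_one]
  push_cast
  rfl

/-- The step function with coefficients `c`. -/
def step (P : PartitionSequence μ) (n : ℕ) (c : Fin (P.q n) → ℂ) : Lp ℂ 2 μ :=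
  ∑ j, c j • P.indicator n j

theorem discretize_eq_step (P : PartitionSequence μ) (n : ℕ) (g : Lp ℂ 2 μ) :
    P.discretize n g = P.step n (P.average n g) := rfl

theorem step_smul (P : PartitionSequence μ) (n : ℕ) (a : ℂ) (c : Fin (P.q n) → ℂ) :
    P.step n (a • c) = a • P.step n c := by
  simp [step, Finset.smul_sum, mul_smul]

theorem step_mem_discreteSpace (P : PartitionSequence μ) (n : ℕ) (c : Fin (P.q n) → ℂ) :
    P.step n c ∈ P.discreteSpace n :=
  Submodule.sum_mem _ fun j _ => Submodule.smul_mem _ _ (Submodule.subset_span ⟨j, rfl⟩)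

/-- Overlaps are null, so the indicators are orthogonal with squared norm `μ(X) / q n`. Averages are
therefore coordinates on `L²_n`. -/
theorem average_step (P : PartitionSequence μ) (hμ : μ Set.univ ≠ 0) (n : ℕ)
    (c : Fin (P.q n) → ℂ) : P.average n (P.step n c) = c := by
  have h1 : (P.q n : ℂ) ≠ 0 := by exact_mod_cast (P.q_pos hμ n).ne'
  have h2 : ((μ.real Set.univ : ℝ) : ℂ) ≠ 0 := by
    rw [Ne, Complex.ofReal_eq_zero, Measure.real, ENNReal.toReal_eq_zero_iff]
    simp [hμ]
  funext j
  rw [average_eq_inner, step, inner_sum]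
  simp_rw [inner_smul_right, inner_indicator]
  simp only [mul_ite, mul_zero, Finset.sum_ite_eq, Finset.mem_univ, if_true]
  push_cast
  field_simp

/-- Reindexing by `σ`: coefficient `j` is carried to position `σ⁻¹ j`, so on coordinates the
operator is composition with `σ`. -/
theorem discreteKoopman_eq_step (P : PartitionSequence μ) (n : ℕ) (σ : Equiv.Perm (Fin (P.q n)))
    (g : Lp ℂ 2 μ) : P.discreteKoopman n σ g = P.step n (P.average n g ∘ σ) := by
  unfold discreteKoopman step
  rw [← Equiv.sum_comp σ]
  simp

theorem discreteKoopman_iterate_step (P : PartitionSequence μ) (hμ : μ Set.univ ≠ 0) (n : ℕ)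
    (σ : Equiv.Perm (Fin (P.q n))) (k : ℕ) (c : Fin (P.q n) → ℂ) :
    (P.discreteKoopman n σ)^[k] (P.step n c) = P.step n (c ∘ (σ ^ k : Equiv.Perm _)) := by
  induction k generalizing c with
  | zero => rfl
  | succ k ih =>
    rw [Function.iterate_succ_apply, discreteKoopman_eq_step, P.average_step hμ, ih, pow_succ']
    rfl

theorem discreteKoopman_sum_smul (P : PartitionSequence μ) (n : ℕ)
    (σ : Equiv.Perm (Fin (P.q n))) {ι : Type*} (s : Finset ι) (a : ι → ℂ) (v : ι → Lp ℂ 2 μ) :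
    P.discreteKoopman n σ (∑ i ∈ s, a i • v i) =
      ∑ i ∈ s, a i • P.discreteKoopman n σ (v i) := by
  unfold discreteKoopman
  simp_rw [average_eq_inner, inner_sum, inner_smul_right, Finset.smul_sum, Finset.mul_sum,
    Finset.sum_smul]
  rw [Finset.sum_comm]
  refine Finset.sum_congr rfl fun i _ => Finset.sum_congr rfl fun j _ => ?_
  rw [smul_smul]
  congr 1
  ring

/-- The indicator functions, divided by their norms. -/
def normalizedIndicator (P : PartitionSequence μ) (n : ℕ) (j : Fin (P.q n)) : Lp ℂ 2 μ :=
  ((Real.sqrt (P.q n / μ.real Set.univ) : ℝ) : ℂ) • P.indicator n j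

theorem orthonormal_normalizedIndicator (P : PartitionSequence μ) (hμ : μ Set.univ ≠ 0) (n : ℕ) :
    Orthonormal ℂ (P.normalizedIndicator n) := by
  have h1 : (P.q n : ℂ) ≠ 0 := by exact_mod_cast (P.q_pos hμ n).ne'
  have h2 : ((μ.real Set.univ : ℝ) : ℂ) ≠ 0 := by
    rw [Ne, Complex.ofReal_eq_zero, Measure.real, ENNReal.toReal_eq_zero_iff]
    simp [hμ]
  rw [orthonormal_iff_ite]
  intro i j
  unfold normalizedIndicator
  rw [inner_smul_left, inner_smul_right, inner_indicator, Complex.conj_ofReal, ← mul_assoc,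
    ← Complex.ofReal_mul, Real.mul_self_sqrt (by positivity)]
  split_ifs
  · push_cast; field_simp
  · rw [mul_zero]

/-- Splitting the factor `q n / μ(X)` into two square roots exhibits averaging as the orthogonal
projection onto `L²_n`, hence as a contraction. -/
theorem discretize_eq_sum_inner (P : PartitionSequence μ) (n : ℕ) (g : Lp ℂ 2 μ) :
    P.discretize n g =
      ∑ j, (inner ℂ (P.normalizedIndicator n j) g : ℂ) • P.normalizedIndicator n j := by
  unfold discretize
  refine Finset.sum_congr rfl fun j _ => ?_
  unfold normalizedIndicator
  rw [inner_smul_left, smul_smul, average_eq_inner, Complex.conj_ofReal, mul_right_comm,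
    ← Complex.ofReal_mul, Real.mul_self_sqrt (by positivity)]

theorem norm_sq_sum_smul {ι : Type*} [Fintype ι] {v : ι → Lp ℂ 2 μ} (hv : Orthonormal ℂ v)
    (a : ι → ℂ) : ‖∑ i, a i • v i‖ ^ 2 = ∑ i, ‖a i‖ ^ 2 := by
  rw [norm_sq_eq_re_inner (𝕜 := ℂ), hv.inner_sum]
  simp [Complex.conj_mul', ← Complex.ofReal_pow]

theorem norm_discretize_le (P : PartitionSequence μ) (hμ : μ Set.univ ≠ 0) (n : ℕ)
    (g : Lp ℂ 2 μ) : ‖P.discretize n g‖ ≤ ‖g‖ := by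
  refine le_of_sq_le_sq ?_ (norm_nonneg _)
  have ho := P.orthonormal_normalizedIndicator hμ n
  rw [discretize_eq_sum_inner, norm_sq_sum_smul ho]
  exact ho.sum_inner_products_le _

theorem norm_step_comp (P : PartitionSequence μ) (hμ : μ Set.univ ≠ 0) (n : ℕ)
    (σ : Equiv.Perm (Fin (P.q n))) (c : Fin (P.q n) → ℂ) :
    ‖P.step n (c ∘ σ)‖ = ‖P.step n c‖ := by
  have hr : (0 : ℝ) < P.q n / μ.real Set.univ := by
    refine div_pos (by exact_mod_cast P.q_pos hμ n) (ENNReal.toReal_pos hμ (measure_ne_top _ _))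
  set r := Real.sqrt (P.q n / μ.real Set.univ) with hrdef
  have hr0 : (r : ℂ) ≠ 0 := by exact_mod_cast (Real.sqrt_pos.2 hr).ne'
  have h : ∀ c, ‖P.step n c‖ ^ 2 = ∑ j, ‖c j * (r : ℂ)⁻¹‖ ^ 2 := by
    intro c
    rw [← norm_sq_sum_smul (P.orthonormal_normalizedIndicator hμ n)]
    congr 2
    refine Finset.sum_congr rfl fun j _ => ?_
    rw [normalizedIndicator, smul_smul, ← hrdef, inv_mul_cancel_right₀ hr0]
  refine (sq_eq_sq₀ (norm_nonneg _) (norm_nonneg _)).1 ?_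
  rw [h, h]
  exact Equiv.sum_comp σ fun j => ‖c j * (r : ℂ)⁻¹‖ ^ 2

theorem norm_discreteKoopman_iterate_discretize_le (P : PartitionSequence μ)
    (hμ : μ Set.univ ≠ 0) (n : ℕ) (σ : Equiv.Perm (Fin (P.q n))) (k : ℕ) (g : Lp ℂ 2 μ) :
    ‖(P.discreteKoopman n σ)^[k] (P.discretize n g)‖ ≤ ‖g‖ := by
  rw [discretize_eq_step, P.discreteKoopman_iterate_step hμ, P.norm_step_comp hμ,
    ← discretize_eq_step]
  exact P.norm_discretize_le hμ n g

theorem discreteKoopman_iterate_discretize_sub (P : PartitionSequence μ)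
    (hμ : μ Set.univ ≠ 0) (n : ℕ) (σ : Equiv.Perm (Fin (P.q n))) (k : ℕ) (g h : Lp ℂ 2 μ) :
    (P.discreteKoopman n σ)^[k] (P.discretize n (g - h)) =
      (P.discreteKoopman n σ)^[k] (P.discretize n g) -
        (P.discreteKoopman n σ)^[k] (P.discretize n h) := by
  simp_rw [discretize_eq_step, P.discreteKoopman_iterate_step hμ, step, ← Finset.sum_sub_distrib,
    ← sub_smul]
  refine Finset.sum_congr rfl fun j _ => ?_
  simp only [Function.comp_apply, average_eq_inner, inner_sub_right, mul_sub]

end Discretization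

/-! ### Diagonalization of the discrete Koopman operator. -/

section Eigenbasis

/-- The operator `c ↦ c ∘ σ`. -/
def permuteCoordinates {N : ℕ} (σ : Equiv.Perm (Fin N)) :
    Module.End ℂ (EuclideanSpace ℂ (Fin N)) :=
  (LinearIsometryEquiv.piLpCongrLeft 2 ℂ ℂ σ.symm).toLinearEquiv.toLinearMap

theorem permuteCoordinates_apply {N : ℕ} (σ : Equiv.Perm (Fin N))
    (c : EuclideanSpace ℂ (Fin N)) (j : Fin N) : permuteCoordinates σ c j = c (σ j) := by
  rfl

theorem inner_permuteCoordinates {N : ℕ} (σ : Equiv.Perm (Fin N))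
    (c d : EuclideanSpace ℂ (Fin N)) :
    inner ℂ (permuteCoordinates σ c) (permuteCoordinates σ d) = inner ℂ c d :=
  (LinearIsometryEquiv.piLpCongrLeft 2 ℂ ℂ σ.symm).inner_map_map c d

theorem permuteCoordinates_pow_apply {N : ℕ} (σ : Equiv.Perm (Fin N)) (k : ℕ)
    (c : EuclideanSpace ℂ (Fin N)) (j : Fin N) :
    (permuteCoordinates σ ^ k) c j = c ((σ ^ k) j) := by
  induction k generalizing c with
  | zero => rfl
  | succ k ih =>
    rw [pow_succ, Module.End.mul_apply, ih, permuteCoordinates_apply, pow_succ']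
    rfl

/-- A permutation has finite order, so the operator is annihilated by `X ^ orderOf σ - 1`, which is
separable in characteristic zero. -/
theorem permuteCoordinates_isSemisimple {N : ℕ} (σ : Equiv.Perm (Fin N)) :
    (permuteCoordinates σ).IsSemisimple := by
  have ho : 0 < orderOf σ := orderOf_pos σ
  refine Module.End.isSemisimple_of_squarefree_aeval_eq_zero
    (p := (Polynomial.X ^ orderOf σ - 1 : Polynomial ℂ)) ?_ ?_
  · exact (Polynomial.separable_X_pow_sub_C (1 : ℂ) (by exact_mod_cast ho.ne')
      one_ne_zero).squarefree
  · ext c j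
    simp [permuteCoordinates_pow_apply, pow_orderOf_eq_one]

theorem norm_eigenvalue_permuteCoordinates {N : ℕ} (σ : Equiv.Perm (Fin N)) {z : ℂ}
    (hz : (permuteCoordinates σ).HasEigenvalue z) : ‖z‖ = 1 := by
  obtain ⟨c, hc⟩ := hz.exists_hasEigenvector
  have h := inner_permuteCoordinates σ c c
  rw [hc.apply_eq_smul, inner_smul_left, inner_smul_right, ← mul_assoc, Complex.conj_mul'] at h
  have h0 : inner ℂ c c ≠ 0 := inner_self_ne_zero.2 hc.2
  have h1 : (‖z‖ : ℂ) ^ 2 = 1 := mul_right_cancel₀ h0 (by rw [h, one_mul])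
  exact (pow_eq_one_iff_of_nonneg (norm_nonneg z) two_ne_zero).1 (by exact_mod_cast h1)

/-- If eigenvectors for `z` and `w` are not orthogonal, invariance of the inner product forces `conj
z * w = 1 = conj z * z`, so `w = z`. -/
theorem orthogonalFamily_permuteCoordinates {N : ℕ} (σ : Equiv.Perm (Fin N)) :
    OrthogonalFamily ℂ (fun z : (permuteCoordinates σ).Eigenvalues =>
      (permuteCoordinates σ).eigenspace z) fun z =>
        ((permuteCoordinates σ).eigenspace z).subtypeₗᵢ := by
  intro z w hzw c d
  have hc := Module.End.mem_eigenspace_iff.1 c.2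
  have hd := Module.End.mem_eigenspace_iff.1 d.2
  have h := inner_permuteCoordinates σ (c : EuclideanSpace ℂ (Fin N)) d
  rw [hc, hd, inner_smul_left, inner_smul_right, ← mul_assoc] at h
  by_contra h0
  have h1 : (starRingEnd ℂ) (z : ℂ) * (w : ℂ) = 1 := mul_right_cancel₀ h0 (by rw [one_mul]; exact h)
  have hz : (starRingEnd ℂ) (z : ℂ) * (z : ℂ) = 1 := by
    have h1 : ‖(z : ℂ)‖ = 1 := norm_eigenvalue_permuteCoordinates σ z.2
    rw [Complex.conj_mul', h1]; simp
  have hne : (starRingEnd ℂ) (z : ℂ) ≠ 0 := fun h => by rw [h, zero_mul] at hz; exact zero_ne_one hz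
  exact hzw (Subtype.ext (mul_left_cancel₀ hne (hz.trans h1.symm)))

/-- Over `ℂ` the generalized eigenspaces span; by semisimplicity they are eigenspaces, and these are
mutually orthogonal. -/
theorem exists_orthonormalBasis_permuteCoordinates {N : ℕ} (σ : Equiv.Perm (Fin N)) :
    ∃ (b : OrthonormalBasis (Fin N) ℂ (EuclideanSpace ℂ (Fin N))) (z : Fin N → ℂ),
      ∀ k, ‖z k‖ = 1 ∧ permuteCoordinates σ (b k) = z k • b k := by
  have ho := orthogonalFamily_permuteCoordinates σ
  have htop : ⨆ z : (permuteCoordinates σ).Eigenvalues, (permuteCoordinates σ).eigenspace z = ⊤ := by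
    rw [eq_top_iff, ← Module.End.iSup_maxGenEigenspace_eq_top (permuteCoordinates σ)]
    refine iSup_le fun z => ?_
    rw [(permuteCoordinates_isSemisimple σ).isFinitelySemisimple.maxGenEigenspace_eq_eigenspace]
    by_cases hz : (permuteCoordinates σ).HasEigenvalue z
    · exact le_iSup (fun z : (permuteCoordinates σ).Eigenvalues =>
        (permuteCoordinates σ).eigenspace z) ⟨z, hz⟩
    · rw [Module.End.hasEigenvalue_iff, not_not] at hz
      rw [hz]; exact bot_le
  have hint : DirectSum.IsInternal fun z : (permuteCoordinates σ).Eigenvalues =>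
      (permuteCoordinates σ).eigenspace z := by
    rw [ho.isInternal_iff, htop, Submodule.top_orthogonal_eq_bot]
  have hN : Module.finrank ℂ (EuclideanSpace ℂ (Fin N)) = N := by simp
  refine ⟨hint.subordinateOrthonormalBasis hN ho,
    fun k => ((hint.subordinateOrthonormalBasisIndex hN k ho :
      (permuteCoordinates σ).Eigenvalues) : ℂ), fun k => ⟨?_, ?_⟩⟩
  · exact norm_eigenvalue_permuteCoordinates σ (hint.subordinateOrthonormalBasisIndex hN k ho).2
  · exact Module.End.mem_eigenspace_iff.1 (hint.subordinateOrthonormalBasis_subordinate hN k ho)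

variable {X : Type*} [MetricSpace X] [MeasurableSpace X] [BorelSpace X] {μ : Measure X}
  [IsFiniteMeasure μ]

/-- The eigenbasis of the permutation matrix is transported by the coordinates; the factor `r`
compensates for the norm of the indicators. -/
theorem exists_isEigenbasis (P : PartitionSequence μ) (hμ : μ Set.univ ≠ 0) (n : ℕ)
    (σ : Equiv.Perm (Fin (P.q n))) :
    ∃ (v : Fin (P.q n) → Lp ℂ 2 μ) (θ : Fin (P.q n) → Phase), P.IsEigenbasis n σ v θ := by
  obtain ⟨b, z, hb⟩ := exists_orthonormalBasis_permuteCoordinates σ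
  set r : ℂ := ((Real.sqrt (P.q n / μ.real Set.univ) : ℝ) : ℂ)
  have hv : ∀ k, P.step n (r • ⇑(b k)) = ∑ j, b k j • P.normalizedIndicator n j := by
    intro k
    refine Finset.sum_congr rfl fun j _ => ?_
    rw [normalizedIndicator, smul_smul, mul_comm (b k j)]
    rfl
  refine ⟨fun k => P.step n (r • ⇑(b k)), fun k => phase (z k),
    fun k => P.step_mem_discreteSpace n _, ?_, fun k => ?_⟩
  · rw [orthonormal_iff_ite]
    intro i j
    rw [hv, hv, (P.orthonormal_normalizedIndicator hμ n).inner_sum,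
      ← orthonormal_iff_ite.1 b.orthonormal i j, PiLp.inner_apply]
    simp [mul_comm]
  · rw [discreteKoopman_eq_step, P.average_step hμ, exp_phase (hb k).1, ← step_smul]
    congr 1
    funext j
    have := congrArg (fun c : EuclideanSpace ℂ (Fin (P.q n)) => c j) (hb k).2
    simp only [permuteCoordinates_apply, PiLp.smul_apply, smul_eq_mul] at this
    simp only [Function.comp_apply, Pi.smul_apply, smul_eq_mul, this]
    ring

/-- There are `q n` orthonormal vectors in a space spanned by `q n` indicators, so they span it. -/
theorem IsEigenbasis.eq_sum_inner {P : PartitionSequence μ} {n : ℕ}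
    {σ : Equiv.Perm (Fin (P.q n))} {v : Fin (P.q n) → Lp ℂ 2 μ} {θ : Fin (P.q n) → Phase}
    (hv : P.IsEigenbasis n σ v θ) {g : Lp ℂ 2 μ} (hg : g ∈ P.discreteSpace n) :
    g = ∑ i, (inner ℂ (v i) g : ℂ) • v i := by
  have hfin : FiniteDimensional ℂ (P.discreteSpace n) :=
    FiniteDimensional.span_of_finite ℂ (Set.finite_range _)
  have hle : Submodule.span ℂ (Set.range v) ≤ P.discreteSpace n :=
    Submodule.span_le.2 (by rintro _ ⟨k, rfl⟩; exact hv.mem k)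
  have heq : Submodule.span ℂ (Set.range v) = P.discreteSpace n := by
    refine Submodule.eq_of_le_of_finrank_le hle ?_
    rw [finrank_span_eq_card hv.orthonormal.linearIndependent]
    exact finrank_range_le_card _
  rw [← heq] at hg
  obtain ⟨c, rfl⟩ := (Submodule.mem_span_range_iff_exists_fun ℂ).1 hg
  simp_rw [hv.orthonormal.inner_right_fintype]

theorem IsEigenbasis.discreteKoopman_iterate {P : PartitionSequence μ} {n : ℕ}
    {σ : Equiv.Perm (Fin (P.q n))} {v : Fin (P.q n) → Lp ℂ 2 μ} {θ : Fin (P.q n) → Phase}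
    (hv : P.IsEigenbasis n σ v θ) (k : ℕ) (a : Fin (P.q n) → ℂ) :
    (P.discreteKoopman n σ)^[k] (∑ i, a i • v i) =
      ∑ i, (a i * Complex.exp (Complex.I * ((θ i : ℝ) : ℂ) * k)) • v i := by
  induction k with
  | zero => simp
  | succ k ih =>
    rw [Function.iterate_succ_apply', ih, discreteKoopman_sum_smul]
    refine Finset.sum_congr rfl fun i _ => ?_
    rw [hv.eigen, smul_smul, mul_assoc, ← Complex.exp_add]
    push_cast
    ring_nf

end Eigenbasis

end PartitionSequence

/-! ### Fourier coefficients of the discrete spectral density. -/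

section DiscreteDensity

variable {H : Type*} [NormedAddCommGroup H] [InnerProductSpace ℂ H]

instance {N : ℕ} (v : Fin N → H) (θ : Fin N → Phase) (g : H) :
    IsFiniteMeasure (discreteDensity v θ g) := by
  refine ⟨?_⟩
  simp [discreteDensity, Measure.finsetSum_apply, ENNReal.sum_lt_top]

theorem integral_discreteDensity {N : ℕ} {v : Fin N → H} (hv : Orthonormal ℂ v)
    (θ : Fin N → Phase) (g : H) (F : Phase → ℂ) :
    ∫ ξ, F ξ ∂(discreteDensity v θ g) = ∑ i, ((‖(inner ℂ (v i) g : ℂ)‖ ^ 2 : ℝ) : ℂ) * F (θ i) := by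
  unfold discreteDensity
  rw [integral_finsetSum_measure fun i _ =>
    (integrable_dirac (by simp)).smul_measure ENNReal.ofReal_ne_top]
  refine Finset.sum_congr rfl fun i _ => ?_
  rw [integral_smul_measure, integral_dirac, ENNReal.toReal_ofReal (by positivity), rankOneProj,
    norm_smul, hv.norm_eq_one, mul_one, Complex.real_smul]

end DiscreteDensity

/-- Expanding `g` in the eigenbasis makes both sides the sum of `|⟨v i, g⟩|²` times the `k`-th power
of the eigenvalue. -/
theorem PartitionSequence.IsEigenbasis.integral_discreteDensity_exp {X : Type*} [MetricSpace X]
    [MeasurableSpace X] [BorelSpace X] {μ : Measure X} [IsFiniteMeasure μ]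
    {P : PartitionSequence μ} {n : ℕ} {σ : Equiv.Perm (Fin (P.q n))} {v : Fin (P.q n) → Lp ℂ 2 μ}
    {θ : Fin (P.q n) → Phase} (hv : P.IsEigenbasis n σ v θ) {g : Lp ℂ 2 μ}
    (hg : g ∈ P.discreteSpace n) (k : ℕ) :
    ∫ ξ : Phase, Complex.exp (Complex.I * ((ξ : ℝ) : ℂ) * (k : ℂ)) ∂(discreteDensity v θ g) =
      inner ℂ g ((P.discreteKoopman n σ)^[k] g) := by
  rw [integral_discreteDensity hv.orthonormal]
  conv_rhs => rw [hv.eq_sum_inner hg, hv.discreteKoopman_iterate, hv.orthonormal.inner_sum]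
  refine Finset.sum_congr rfl fun i _ => ?_
  rw [← mul_assoc, Complex.conj_mul']
  push_cast
  rfl

namespace PartitionSequence

/-! ### Strong convergence of the discrete Koopman operators. -/

section Convergence

variable {X : Type*} [MetricSpace X] [CompactSpace X] [MeasurableSpace X] [BorelSpace X]
  {μ : Measure X}

/-- The approximation is used only for `A = {x}` and the single term `l = k`: the Hausdorff distance
of a set to a point bounds the distance of each of its points. The threshold for `n` may depend on
`x`, which dominated convergence tolerates. -/
theorem PeriodicallyApproximates.eventually_dist_lt {P : PartitionSequence μ}
    {σ : (n : ℕ) → Equiv.Perm (Fin (P.q n))} {T : X ≃ₜ X} (h : P.PeriodicallyApproximates σ T)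
    (k : ℕ) (x : X) {ε : ℝ} (hε : 0 < ε) :
    ∀ᶠ n in atTop, ∀ j, x ∈ P.p n j → ∀ z ∈ P.p n ((σ n ^ k) j), dist z ((T ^ k) x) < ε := by
  filter_upwards [(h k {x} isCompact_singleton).eventually_lt_const hε] with n hn j hj z hz
  set B : Set X := ⋃ i ∈ {i | (P.p n i ∩ {x}).Nonempty}, P.p n ((σ n ^ (k : ℤ)) i) with hB
  have hzB : z ∈ B := by
    refine Set.mem_biUnion (x := j) ⟨x, hj, rfl⟩ ?_
    rwa [zpow_natCast]
  have hle : Metric.hausdorffDist ((T ^ (k : ℤ) : X ≃ₜ X) '' {x}) B < ε := by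
    refine lt_of_le_of_lt ?_ hn
    exact Finset.single_le_sum (f := fun l : ℤ => Metric.hausdorffDist ((T ^ l : X ≃ₜ X) '' {x})
      (⋃ i ∈ {i | (P.p n i ∩ {x}).Nonempty}, P.p n ((σ n ^ l) i)))
      (fun _ _ => Metric.hausdorffDist_nonneg) (Finset.mem_Icc.2 ⟨by omega, le_rfl⟩)
  rw [Set.image_singleton, zpow_natCast, Metric.hausdorffDist_comm] at hle
  -- `hausdorffDist` is 0 when the extended distance is infinite, so finiteness is needed before
  -- reading off distances.
  have hfin : Metric.hausdorffEDist B {(T ^ k) x} ≠ ⊤ :=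
    Metric.hausdorffEDist_ne_top_of_nonempty_of_bounded ⟨z, hzB⟩ (Set.singleton_nonempty _)
      (Metric.isBounded_of_compactSpace) (Metric.isBounded_of_compactSpace)
  have := Metric.infDist_le_hausdorffDist_of_mem hzB hfin
  rw [Metric.infDist_singleton] at this
  exact this.trans_lt hle

variable [IsFiniteMeasure μ]

/-- The left side is the mean of `f - w` over the cell. Later `w` is `f` at `T^k x` for convergence,
and 0 for the dominating bound. -/
theorem norm_average_toLp_sub_le (P : PartitionSequence μ) (hμ : μ Set.univ ≠ 0) (n : ℕ)
    (f : C(X, ℂ)) (j : Fin (P.q n)) (w : ℂ) {δ : ℝ} (hδ : ∀ z ∈ P.p n j, ‖f z - w‖ ≤ δ) :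
    ‖P.average n (ContinuousMap.toLp 2 μ ℂ f) j - w‖ ≤ δ := by
  have hm : MeasurableSet (P.p n j) := (P.isCompact n j).measurableSet
  have hq : (0 : ℝ) < P.q n := by exact_mod_cast P.q_pos hμ n
  have hM : 0 < μ.real Set.univ := ENNReal.toReal_pos hμ (measure_ne_top _ _)
  have hq' : (P.q n : ℂ) ≠ 0 := by exact_mod_cast hq.ne'
  have hM' : ((μ.real Set.univ : ℝ) : ℂ) ≠ 0 := by exact_mod_cast hM.ne'
  have hfi : Integrable f μ :=
    f.continuous.integrable_of_hasCompactSupport (HasCompactSupport.of_compactSpace _)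
  have hint : ∫ x in P.p n j, ContinuousMap.toLp 2 μ ℂ f x ∂μ = ∫ x in P.p n j, f x ∂μ :=
    integral_congr_ae (ae_restrict_of_ae (ContinuousMap.coeFn_toLp μ f))
  have hsub : P.average n (ContinuousMap.toLp 2 μ ℂ f) j - w =
      ((P.q n : ℂ) / ((μ.real Set.univ : ℝ) : ℂ)) * ∫ x in P.p n j, (f x - w) ∂μ := by
    rw [average, hint, integral_sub hfi.integrableOn (integrable_const w), mul_sub,
      setIntegral_const, P.measureReal_eq, Complex.real_smul]
    push_cast
    field_simp
  have hb := norm_setIntegral_le_of_norm_le_const (μ := μ) (f := fun x => f x - w)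
    (measure_lt_top μ (P.p n j)) hδ
  rw [hsub, norm_mul, norm_div, Complex.norm_real, Complex.norm_natCast,
    Real.norm_of_nonneg hM.le]
  rw [P.measureReal_eq] at hb
  calc _ ≤ (P.q n : ℝ) / μ.real Set.univ * (δ * (μ.real Set.univ / P.q n)) := by gcongr
    _ = δ := by field_simp

theorem step_ae_eq (P : PartitionSequence μ) (n : ℕ) (c : Fin (P.q n) → ℂ) :
    ∀ᵐ x ∂μ, ∀ j, x ∈ P.p n j → P.step n c x = c j := by
  have h1 : ∀ᵐ x ∂μ, ∀ j, P.indicator n j x = (P.p n j).indicator (fun _ => (1 : ℂ)) x :=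
    ae_all_iff.2 fun j => indicatorConstLp_coeFn
  have h2 : ∀ᵐ x ∂μ, ∀ j, (c j • P.indicator n j : Lp ℂ 2 μ) x = c j * P.indicator n j x :=
    ae_all_iff.2 fun j => by
      filter_upwards [Lp.coeFn_smul (c j) (P.indicator n j)] with x hx
      rw [hx]; rfl
  filter_upwards [P.ae_existsUnique_mem n, h1, h2, Lp.coeFn_finsetSum Finset.univ fun j => c j • P.indicator n j] with x hx h1 h2 h3 j hj
  change (∑ j, c j • P.indicator n j : Lp ℂ 2 μ) x = c j
  rw [h3, Finset.sum_apply, Finset.sum_eq_single j]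
  · rw [h2, h1, Set.indicator_of_mem hj, mul_one]
  · intro i _ hij
    rw [h2, h1, Set.indicator_of_notMem (fun hi => hij (hx.unique hi hj)), mul_zero]
  · simp

theorem koopman_pow_toLp (T : X ≃ₜ X) (hT : MeasurePreserving T μ μ) (k : ℕ) (f : C(X, ℂ)) :
    (koopman T hT ^ k) (ContinuousMap.toLp 2 μ ℂ f) =
      ContinuousMap.toLp 2 μ ℂ (f.comp ((T ^ k : X ≃ₜ X) : C(X, X))) := by
  have h1 : ∀ f : C(X, ℂ), koopman T hT (ContinuousMap.toLp 2 μ ℂ f) =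
      ContinuousMap.toLp 2 μ ℂ (f.comp (T : C(X, X))) := by
    intro f
    apply Lp.ext
    filter_upwards [koopman_coeFn T hT (ContinuousMap.toLp 2 μ ℂ f),
      ContinuousMap.coeFn_toLp (p := 2) (𝕜 := ℂ) μ (f.comp (T : C(X, X))),
      hT.quasiMeasurePreserving.ae (ContinuousMap.coeFn_toLp (p := 2) (𝕜 := ℂ) μ f)]
      with x hx1 hx2 hx3
    rw [hx1, hx2, Function.comp_apply, hx3]
    rfl
  induction k generalizing f with
  | zero => rfl
  | succ k ih =>
    rw [pow_succ]
    change (koopman T hT ^ k) (koopman T hT (ContinuousMap.toLp 2 μ ℂ f)) = _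
    rw [h1, ih, pow_succ']
    rfl

/-- Almost everywhere the difference is the mean of `f` over `p n ((σ n ^ k) j)` minus `f` at `T^k
x`, with `x ∈ p n j`. It tends to zero pointwise and is bounded by `2‖f‖`, so its squared norm has
integral tending to zero. -/
theorem tendsto_discreteKoopman_toLp (P : PartitionSequence μ) (hμ : μ Set.univ ≠ 0)
    {σ : (n : ℕ) → Equiv.Perm (Fin (P.q n))} {T : X ≃ₜ X} (hT : MeasurePreserving T μ μ)
    (h : P.PeriodicallyApproximates σ T) (k : ℕ) (f : C(X, ℂ)) :
    Tendsto (fun n => (P.discreteKoopman n (σ n))^[k]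
      (P.discretize n (ContinuousMap.toLp 2 μ ℂ f))) atTop
      (𝓝 ((koopman T hT ^ k) (ContinuousMap.toLp 2 μ ℂ f))) := by
  set G : Lp ℂ 2 μ := (koopman T hT ^ k) (ContinuousMap.toLp 2 μ ℂ f) with hG
  set c : (n : ℕ) → Fin (P.q n) → ℂ := fun n =>
    P.average n (ContinuousMap.toLp 2 μ ℂ f) ∘ (σ n ^ k : Equiv.Perm _) with hc
  have hstep : ∀ n, (P.discreteKoopman n (σ n))^[k]
      (P.discretize n (ContinuousMap.toLp 2 μ ℂ f)) = P.step n (c n) := fun n => by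
    rw [discretize_eq_step, P.discreteKoopman_iterate_step hμ]
  simp_rw [hstep]
  have hae : ∀ᵐ x ∂μ, ∀ n, ∀ j, x ∈ P.p n j →
      (P.step n (c n) - G : Lp ℂ 2 μ) x =
        P.average n (ContinuousMap.toLp 2 μ ℂ f) ((σ n ^ k) j) - f ((T ^ k) x) := by
    rw [ae_all_iff]
    intro n
    have hGx : G =ᵐ[μ] fun x => f ((T ^ k) x) := by
      rw [hG, koopman_pow_toLp]
      exact ContinuousMap.coeFn_toLp μ _
    filter_upwards [Lp.coeFn_sub (P.step n (c n)) G, P.step_ae_eq n (c n), hGx]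
      with x h1 h2 h3 j hj
    rw [h1, Pi.sub_apply, h2 j hj, h3]
    rfl
  have hcov : ∀ n (x : X), ∃ j, x ∈ P.p n j := fun n x =>
    Set.mem_iUnion.1 (by rw [P.iUnion_eq]; trivial)
  have hint : Tendsto (fun n => ∫ x, inner ℂ ((P.step n (c n) - G : Lp ℂ 2 μ) x)
      ((P.step n (c n) - G : Lp ℂ 2 μ) x) ∂μ) atTop (𝓝 (∫ _, (0 : ℂ) ∂μ)) := by
    refine tendsto_integral_of_dominated_convergence (fun _ => (‖f‖ + ‖f‖) * (‖f‖ + ‖f‖)) ?_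
      (integrable_const _) ?_ ?_
    · intro n
      exact (Lp.aestronglyMeasurable _).inner (Lp.aestronglyMeasurable _)
    · intro n
      filter_upwards [hae] with x hx
      obtain ⟨j, hj⟩ := hcov n x
      have hb : ‖(P.step n (c n) - G : Lp ℂ 2 μ) x‖ ≤ ‖f‖ + ‖f‖ := by
        rw [hx n j hj]
        refine (norm_sub_le _ _).trans (add_le_add ?_ (f.norm_coe_le_norm _))
        simpa using P.norm_average_toLp_sub_le hμ n f ((σ n ^ k) j) 0
          (fun z _ => by simpa using f.norm_coe_le_norm z)
      exact (norm_inner_le_norm _ _).trans (by gcongr)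
    · filter_upwards [hae] with x hx
      have ht : Tendsto (fun n => (P.step n (c n) - G : Lp ℂ 2 μ) x) atTop (𝓝 0) := by
        rw [Metric.tendsto_nhds]
        intro ε hε
        obtain ⟨δ, hδ, hfδ⟩ := Metric.continuous_iff.1 f.continuous ((T ^ k) x) (ε / 2) (by linarith)
        filter_upwards [h.eventually_dist_lt k x hδ] with n hn
        obtain ⟨j, hj⟩ := hcov n x
        rw [dist_zero_right, hx n j hj]
        refine lt_of_le_of_lt (P.norm_average_toLp_sub_le hμ n f _ _ fun z hz => ?_)
          (half_lt_self hε)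
        rw [← dist_eq_norm]
        exact (hfδ z (hn j hj z hz)).le
      simpa using ht.inner ht (𝕜 := ℂ)
  rw [tendsto_iff_norm_sub_tendsto_zero]
  have hsq : Tendsto (fun n => ‖P.step n (c n) - G‖ ^ 2) atTop (𝓝 0) := by
    have h2 := (Complex.continuous_re.tendsto _).comp hint
    simp only [integral_zero, Complex.zero_re] at h2
    refine h2.congr fun n => ?_
    rw [norm_sq_eq_re_inner (𝕜 := ℂ), L2.inner_def]
    rfl
  have h3 := (Real.continuous_sqrt.tendsto _).comp hsq
  simpa only [Function.comp_def, Real.sqrt_sq (norm_nonneg _), Real.sqrt_zero] using h3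

/-- The powers of the discrete Koopman operators converge strongly to those of the Koopman
operator. -/
theorem tendsto_discreteKoopman (P : PartitionSequence μ) (hμ : μ Set.univ ≠ 0)
    {σ : (n : ℕ) → Equiv.Perm (Fin (P.q n))} {T : X ≃ₜ X} (hT : MeasurePreserving T μ μ)
    (h : P.PeriodicallyApproximates σ T) (k : ℕ) (g : Lp ℂ 2 μ) :
    Tendsto (fun n => (P.discreteKoopman n (σ n))^[k] (P.discretize n g)) atTop
      (𝓝 ((koopman T hT ^ k) g)) := by
  rw [Metric.tendsto_nhds]
  intro ε hε
  obtain ⟨f, hf⟩ := (ContinuousMap.toLp_denseRange (p := 2) ℂ μ ℂ (by simp)).exists_dist_lt g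
    (show 0 < ε / 3 by linarith)
  filter_upwards [Metric.tendsto_nhds.1 (P.tendsto_discreteKoopman_toLp hμ hT h k f) (ε / 3)
    (by linarith)] with n hn
  set F : Lp ℂ 2 μ := ContinuousMap.toLp 2 μ ℂ f
  -- The discrete maps contract uniformly in `n`, so replacing `g` by a continuous function costs at
  -- most `ε / 3` for every `n`.
  have h1 : dist ((P.discreteKoopman n (σ n))^[k] (P.discretize n g))
      ((P.discreteKoopman n (σ n))^[k] (P.discretize n F)) ≤ dist g F := by
    rw [dist_eq_norm, dist_eq_norm, ← P.discreteKoopman_iterate_discretize_sub hμ]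
    exact P.norm_discreteKoopman_iterate_discretize_le hμ n (σ n) k _
  have h2 : dist ((koopman T hT ^ k) F) ((koopman T hT ^ k) g) = dist g F := by
    rw [LinearIsometryEquiv.dist_map, dist_comm]
  have := dist_triangle4 ((P.discreteKoopman n (σ n))^[k] (P.discretize n g))
    ((P.discreteKoopman n (σ n))^[k] (P.discretize n F)) ((koopman T hT ^ k) F)
    ((koopman T hT ^ k) g)
  linarith

/-- The left factor is covered by exponent 0, which says that `g_n → g`. -/
theorem tendsto_inner_discreteKoopman (P : PartitionSequence μ) (hμ : μ Set.univ ≠ 0)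
    {σ : (n : ℕ) → Equiv.Perm (Fin (P.q n))} {T : X ≃ₜ X} (hT : MeasurePreserving T μ μ)
    (h : P.PeriodicallyApproximates σ T) (k : ℕ) (g : Lp ℂ 2 μ) :
    Tendsto (fun n => inner ℂ (P.discretize n g)
      ((P.discreteKoopman n (σ n))^[k] (P.discretize n g))) atTop
      (𝓝 (inner ℂ g ((koopman T hT ^ k) g))) :=
  (P.tendsto_discreteKoopman hμ hT h 0 g).inner (P.tendsto_discreteKoopman hμ hT h k g)

end Convergence

end PartitionSequence

/-! ### Smoothing as convolution on the circle. -/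

section Smoothing

theorem two_pi_pos : 0 < 2 * Real.pi := by positivity

instance : Fact (0 < 2 * Real.pi) := ⟨two_pi_pos⟩

/-- Differences lie in `(-2π, 2π)`; those larger than `π` in absolute value are shifted by one
period into the range where the quotient norm is the absolute value. -/
theorem circleDist_eq_norm (x y : Phase) :
    circleDist x y = ‖(((x : ℝ) - y : ℝ) : AddCircle (2 * Real.pi))‖ := by
  have hx := x.2
  have hy := y.2
  have hp := Real.pi_pos
  have h2 : |2 * Real.pi| = 2 * Real.pi := abs_of_pos two_pi_pos
  unfold circleDist
  set t : ℝ := (x : ℝ) - y with ht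
  have ht1 : -(2 * Real.pi) < t := by linarith [hx.1, hy.2]
  have ht2 : t < 2 * Real.pi := by linarith [hx.2, hy.1]
  clear_value t
  have key : ∀ s : ℝ, |s| ≤ Real.pi → ‖(s : AddCircle (2 * Real.pi))‖ = |s| := fun s hs =>
    (AddCircle.norm_coe_eq_abs_iff (2 * Real.pi) two_pi_pos.ne').2 (by rw [h2]; linarith)
  rcases le_or_gt |t| Real.pi with h | h
  · rw [key t h, min_eq_left (by linarith)]
  · rw [min_eq_right (by linarith)]
    rcases lt_abs.1 h with h' | h'
    · have e : (t : AddCircle (2 * Real.pi)) = ((t - 2 * Real.pi : ℝ) : AddCircle _) := by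
        rw [AddCircle.coe_sub, AddCircle.coe_period, sub_zero]
      rw [e, key _ (by rw [abs_le]; constructor <;> linarith), abs_of_pos (by linarith),
        abs_of_neg (by linarith)]
      ring
    · have e : (t : AddCircle (2 * Real.pi)) = ((t + 2 * Real.pi : ℝ) : AddCircle _) := by
        rw [AddCircle.coe_add, AddCircle.coe_period, add_zero]
      rw [e, key _ (by rw [abs_le]; constructor <;> linarith), abs_of_neg (by linarith),
        abs_of_pos (by linarith)]
      ring

/-- The kernel `φ_α` as a function of the difference of its arguments on the circle. -/
def bumpProfile (α : ℝ) : C(AddCircle (2 * Real.pi), ℂ) where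
  -- `expNegInvGlue` joins the exponential to 0 continuously at distance `α`. Continuity is all that
  -- is needed; for `α > π` the profile has a kink at the antipode.
  toFun z := (((∫ t in (-1 : ℝ)..1, Real.exp (-1 / (1 - t ^ 2)))⁻¹ / α *
    expNegInvGlue (1 - (‖z‖ / α) ^ 2) : ℝ) : ℂ)
  continuous_toFun := by
    have : Continuous expNegInvGlue := (expNegInvGlue.contDiff (n := 0)).continuous
    fun_prop

theorem bumpKernel_eq_bumpProfile {α : ℝ} (hα : 0 < α) (x y : Phase) :
    ((bumpKernel α x y : ℝ) : ℂ) = bumpProfile α (((x : ℝ) - y : ℝ) : AddCircle (2 * Real.pi)) := by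
  change _ = (((∫ t in (-1 : ℝ)..1, Real.exp (-1 / (1 - t ^ 2)))⁻¹ / α *
    expNegInvGlue (1 - (‖(((x : ℝ) - y : ℝ) : AddCircle (2 * Real.pi))‖ / α) ^ 2) : ℝ) : ℂ)
  rw [← circleDist_eq_norm]
  congr 1
  have h0 : 0 ≤ circleDist x y / α := by rw [circleDist_eq_norm]; positivity
  unfold bumpKernel
  split_ifs with h
  · have h1 : 0 < 1 - (circleDist x y / α) ^ 2 := by nlinarith
    rw [expNegInvGlue, if_neg (not_le.2 h1), neg_div, one_div]
  · have h1 : 1 - (circleDist x y / α) ^ 2 ≤ 0 := by nlinarith [not_lt.1 h]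
    rw [expNegInvGlue.zero_of_nonpos h1, mul_zero]

theorem ofReal_smoothDensity {α : ℝ} (hα : 0 < α) (ρ : Measure Phase) (t : Phase) :
    ((smoothDensity α ρ t : ℝ) : ℂ) =
      ∫ ξ : Phase, bumpProfile α (((t : ℝ) - ξ : ℝ) : AddCircle (2 * Real.pi)) ∂ρ := by
  rw [smoothDensity, ← integral_complex_ofReal]
  simp_rw [bumpKernel_eq_bumpProfile hα]

theorem integrable_translate (h : C(AddCircle (2 * Real.pi), ℂ)) (ρ : Measure Phase)
    [IsFiniteMeasure ρ] (t : Phase) :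
    Integrable (fun ξ : Phase => h (((t : ℝ) - ξ : ℝ) : AddCircle (2 * Real.pi))) ρ := by
  refine Integrable.of_bound ?_ ‖h‖ (Eventually.of_forall fun ξ => h.norm_coe_le_norm _)
  have hc : Continuous fun ξ : Phase => h (((t : ℝ) - ξ : ℝ) : AddCircle (2 * Real.pi)) :=
    h.continuous.comp ((AddCircle.continuous_mk' _).comp (by fun_prop))
  exact hc.measurable.aestronglyMeasurable

/-- A character separates the variables: its convolution with a measure is a unimodular function of
`t` times a Fourier coefficient, so convergence is uniform in `t`. -/
theorem fourier_sub (k : ℤ) (t ξ : Phase) :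
    fourier k ((((t : ℝ) - ξ : ℝ)) : AddCircle (2 * Real.pi)) =
      Complex.exp (Complex.I * ((t : ℝ) : ℂ) * (k : ℂ)) *
        Complex.exp (Complex.I * ((ξ : ℝ) : ℂ) * ((-k : ℤ) : ℂ)) := by
  have : (Real.pi : ℂ) ≠ 0 := by exact_mod_cast Real.pi_ne_zero
  rw [fourier_coe_apply, ← Complex.exp_add]
  congr 1
  push_cast
  field_simp
  ring

theorem norm_exp_I_mul_mul (t : ℝ) (k : ℤ) :
    ‖Complex.exp (Complex.I * (t : ℂ) * (k : ℂ))‖ = 1 := by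
  have : Complex.I * (t : ℂ) * (k : ℂ) = ((t * k : ℝ) : ℂ) * Complex.I := by push_cast; ring
  rw [this, Complex.norm_exp_ofReal_mul_I]

/-- If the Fourier coefficients of bounded measures on the circle converge, then so do their
convolutions with a continuous function, uniformly. -/
theorem tendstoUniformly_integral_translate {ρ : ℕ → Measure Phase} [∀ n, IsFiniteMeasure (ρ n)]
    {ρ₀ : Measure Phase} [IsFiniteMeasure ρ₀] {M : ℝ} (hM : ∀ n, (ρ n).real Set.univ ≤ M)
    (hM₀ : ρ₀.real Set.univ ≤ M)
    (hρ : ∀ k : ℤ, Tendsto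
      (fun n => ∫ ξ : Phase, Complex.exp (Complex.I * ((ξ : ℝ) : ℂ) * (k : ℂ)) ∂(ρ n)) atTop
      (𝓝 (∫ ξ : Phase, Complex.exp (Complex.I * ((ξ : ℝ) : ℂ) * (k : ℂ)) ∂ρ₀)))
    (h : C(AddCircle (2 * Real.pi), ℂ)) :
    TendstoUniformly
      (fun n (t : Phase) => ∫ ξ : Phase, h (((t : ℝ) - ξ : ℝ) : AddCircle (2 * Real.pi)) ∂(ρ n))
      (fun t : Phase => ∫ ξ : Phase, h (((t : ℝ) - ξ : ℝ) : AddCircle (2 * Real.pi)) ∂ρ₀)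
      atTop := by
  have hspan : ∀ f ∈ Submodule.span ℂ (Set.range (fourier (T := 2 * Real.pi))),
      TendstoUniformly
        (fun n (t : Phase) => ∫ ξ : Phase, f (((t : ℝ) - ξ : ℝ) : AddCircle (2 * Real.pi)) ∂(ρ n))
        (fun t : Phase => ∫ ξ : Phase, f (((t : ℝ) - ξ : ℝ) : AddCircle (2 * Real.pi)) ∂ρ₀)
        atTop := by
    intro f hf
    induction hf using Submodule.span_induction with
    | mem f hf =>
      obtain ⟨k, rfl⟩ := hf
      simp_rw [fourier_sub, integral_const_mul]
      rw [Metric.tendstoUniformly_iff]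
      intro ε hε
      filter_upwards [Metric.tendsto_nhds.1 (hρ (-k)) ε hε] with n hn t
      rw [dist_eq_norm, ← mul_sub, norm_mul, norm_exp_I_mul_mul, one_mul, ← dist_eq_norm, dist_comm]
      exact hn
    | zero =>
      simp only [ContinuousMap.zero_apply, integral_zero]
      rw [Metric.tendstoUniformly_iff]
      intro ε hε
      exact Eventually.of_forall fun n t => by simpa using hε
    | add f₁ f₂ _ _ h₁ h₂ =>
      simp_rw [ContinuousMap.add_apply]
      simp_rw [integral_add (integrable_translate f₁ _ _) (integrable_translate f₂ _ _)]
      exact h₁.add h₂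
    | smul a f _ h₁ =>
      simp_rw [ContinuousMap.smul_apply, integral_smul]
      exact (uniformContinuous_const_smul a).comp_tendstoUniformly h₁
  have hM0 : 0 ≤ M := measureReal_nonneg.trans hM₀
  rw [Metric.tendstoUniformly_iff]
  intro ε hε
  -- Approximating `h` within `δ` changes each convolution by at most `δ * M < ε / 3`; the `+ 1`
  -- covers `M = 0`.
  set δ := ε / (3 * (M + 1)) with hδdef
  have hδ : 0 < δ := by positivity
  have hcl : h ∈ closure (Submodule.span ℂ (Set.range (fourier (T := 2 * Real.pi))) :
      Set C(AddCircle (2 * Real.pi), ℂ)) := by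
    rw [← Submodule.topologicalClosure_coe, span_fourier_closure_eq_top]
    trivial
  obtain ⟨f, hf, hhf⟩ := Metric.mem_closure_iff.1 hcl δ hδ
  have hclose : ∀ (m : Measure Phase) [IsFiniteMeasure m], m.real Set.univ ≤ M → ∀ t : Phase,
      dist (∫ ξ : Phase, h (((t : ℝ) - ξ : ℝ) : AddCircle (2 * Real.pi)) ∂m)
        (∫ ξ : Phase, f (((t : ℝ) - ξ : ℝ) : AddCircle (2 * Real.pi)) ∂m) < ε / 3 := by
    intro m _ hm t
    rw [dist_eq_norm, ← integral_sub (integrable_translate h m t) (integrable_translate f m t)]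
    refine (norm_integral_le_of_norm_le_const (C := δ) (Eventually.of_forall fun ξ => ?_)).trans_lt ?_
    · rw [← dist_eq_norm]
      exact (ContinuousMap.dist_apply_le_dist _).trans hhf.le
    · calc δ * m.real Set.univ ≤ δ * M := by gcongr
        _ < δ * (M + 1) := by gcongr; linarith
        _ = ε / 3 := by rw [hδdef]; field_simp
  filter_upwards [Metric.tendstoUniformly_iff.1 (hspan f hf) (ε / 3) (by linarith)] with n hn t
  have h1 := hclose ρ₀ hM₀ t
  have h2 := hclose (ρ n) (hM n) t
  rw [dist_comm] at h2
  have h4 := dist_triangle4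
    (∫ ξ : Phase, h (((t : ℝ) - ξ : ℝ) : AddCircle (2 * Real.pi)) ∂ρ₀)
    (∫ ξ : Phase, f (((t : ℝ) - ξ : ℝ) : AddCircle (2 * Real.pi)) ∂ρ₀)
    (∫ ξ : Phase, f (((t : ℝ) - ξ : ℝ) : AddCircle (2 * Real.pi)) ∂(ρ n))
    (∫ ξ : Phase, h (((t : ℝ) - ξ : ℝ) : AddCircle (2 * Real.pi)) ∂(ρ n))
  linarith [hn t]

/-- Uniform convergence of the smoothed densities follows from convergence of the Fourier
coefficients of non-negative index. -/
theorem tendstoUniformly_smoothDensity {ρ : ℕ → Measure Phase} [∀ n, IsFiniteMeasure (ρ n)]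
    {ρ₀ : Measure Phase} [IsFiniteMeasure ρ₀] {M : ℝ} (hM : ∀ n, (ρ n).real Set.univ ≤ M)
    (hM₀ : ρ₀.real Set.univ ≤ M)
    (hρ : ∀ k : ℕ, Tendsto
      (fun n => ∫ ξ : Phase, Complex.exp (Complex.I * ((ξ : ℝ) : ℂ) * (k : ℂ)) ∂(ρ n)) atTop
      (𝓝 (∫ ξ : Phase, Complex.exp (Complex.I * ((ξ : ℝ) : ℂ) * (k : ℂ)) ∂ρ₀)))
    {α : ℝ} (hα : 0 < α) :
    TendstoUniformly (fun n (t : Phase) => smoothDensity α (ρ n) t)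
      (fun t : Phase => smoothDensity α ρ₀ t) atTop := by
  have hneg : ∀ (m : Measure Phase) (k : ℕ),
      ∫ ξ : Phase, Complex.exp (Complex.I * ((ξ : ℝ) : ℂ) * ((-(k : ℤ) : ℤ) : ℂ)) ∂m =
        (starRingEnd ℂ) (∫ ξ : Phase, Complex.exp (Complex.I * ((ξ : ℝ) : ℂ) * (k : ℂ)) ∂m) := by
    intro m k
    rw [← integral_conj]
    refine integral_congr_ae (Eventually.of_forall fun θ => ?_)
    simp [← Complex.exp_conj]
  have hρ' : ∀ k : ℤ, Tendsto
      (fun n => ∫ ξ : Phase, Complex.exp (Complex.I * ((ξ : ℝ) : ℂ) * (k : ℂ)) ∂(ρ n)) atTop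
      (𝓝 (∫ ξ : Phase, Complex.exp (Complex.I * ((ξ : ℝ) : ℂ) * (k : ℂ)) ∂ρ₀)) := by
    intro k
    obtain ⟨m, rfl | rfl⟩ := k.eq_nat_or_neg
    · simpa using hρ m
    · simp_rw [hneg]
      exact (Complex.continuous_conj.tendsto _).comp (hρ m)
  have h := tendstoUniformly_integral_translate hM hM₀ hρ' (bumpProfile α)
  simp_rw [← ofReal_smoothDensity hα] at h
  rw [Metric.tendstoUniformly_iff] at h ⊢
  intro ε hε
  filter_upwards [h ε hε] with n hn t
  have := hn t
  rwa [Complex.dist_eq, ← Complex.ofReal_sub, Complex.norm_real, ← dist_eq_norm] at this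

end Smoothing

theorem measureReal_univ_spectralDensity {H : Type*} [NormedAddCommGroup H]
    [InnerProductSpace ℂ H] [CompleteSpace H] (S : ProjectionValuedMeasure Phase H) (g : H) :
    (spectralDensity S g).real Set.univ = ‖g‖ ^ 2 := by
  rw [Measure.real, spectralDensity, S.scalarMeasure_apply g MeasurableSet.univ,
    S.re_inner_proj MeasurableSet.univ, S.proj_univ, ENNReal.toReal_ofReal (by positivity)]
  simp

/-- Bessel's inequality; it supplies the mass bound uniform in `n`. -/
theorem measureReal_univ_discreteDensity_le {H : Type*} [NormedAddCommGroup H]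
    [InnerProductSpace ℂ H] {N : ℕ} {v : Fin N → H} (hv : Orthonormal ℂ v) (θ : Fin N → Phase)
    (g : H) : (discreteDensity v θ g).real Set.univ ≤ ‖g‖ ^ 2 := by
  have h := integral_discreteDensity hv θ g fun _ => 1
  rw [integral_const, Complex.real_smul, mul_one] at h
  have h' : (discreteDensity v θ g).real Set.univ = ∑ i, ‖(inner ℂ (v i) g : ℂ)‖ ^ 2 := by
    simp only [mul_one] at h
    exact_mod_cast h
  rw [h']
  exact hv.sum_inner_products_le _

end KoopmanSpectra

end

/-! ### Assembly. -/

open KoopmanSpectra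
theorem mainTheorem2 {E : Type*} [NormedAddCommGroup E] [NormedSpace ℝ E] [FiniteDimensional ℝ E]
    [MeasurableSpace E] [BorelSpace E] (ν : Measure E) [ν.IsAddHaarMeasure]
    (X : Set E) (hX : IsCompact X)
    (μ : Measure X) [IsFiniteMeasure μ] [μ.IsOpenPosMeasure]
    (hμ : μ.map ((↑) : X → E) ≪ ν)
    (T : X ≃ₜ X) (hT : MeasurePreserving T μ μ)
    (P : PartitionSequence μ) (σ : (n : ℕ) → Equiv.Perm (Fin (P.q n)))
    (hσ : P.PeriodicallyApproximates σ T) :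
    (∃ S : ProjectionValuedMeasure Phase (Lp ℂ 2 μ), IsSpectralResolution (koopman T hT) S) ∧
    (∀ n, ∃ (v : Fin (P.q n) → Lp ℂ 2 μ) (θ : Fin (P.q n) → Phase),
      P.IsEigenbasis n (σ n) v θ) ∧
    ∀ (S : ProjectionValuedMeasure Phase (Lp ℂ 2 μ)), IsSpectralResolution (koopman T hT) S →
    ∀ (v : (n : ℕ) → Fin (P.q n) → Lp ℂ 2 μ) (θ : (n : ℕ) → Fin (P.q n) → Phase),
      (∀ n, P.IsEigenbasis n (σ n) (v n) (θ n)) →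
    ∀ (g : Lp ℂ 2 μ) (α : ℝ), 0 < α → α < 2 * Real.pi →
      TendstoUniformly
        (fun (n : ℕ) (t : Phase) =>
          smoothDensity α (discreteDensity (v n) (θ n) (P.discretize n g)) t)
        (fun t : Phase => smoothDensity α (spectralDensity S g) t) atTop := by
  have : CompactSpace X := isCompact_iff_compactSpace.1 hX
  have hne : Nonempty X := by
    -- Index 1 is taken because strict monotonicity alone does not exclude `q 0 = 0`. A cell is
    -- nonempty, so `X` is, and full support gives `μ(X) ≠ 0`.
    have hq : 0 < P.q 1 := lt_of_le_of_lt (Nat.zero_le _) (P.q_strictMono zero_lt_one)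
    obtain ⟨x, -⟩ := (P.isConnected 1 ⟨0, hq⟩).nonempty
    exact ⟨x⟩
  have hμ0 : μ Set.univ ≠ 0 := isOpen_univ.measure_ne_zero μ Set.univ_nonempty
  refine ⟨exists_isSpectralResolution _, fun n => P.exists_isEigenbasis hμ0 n (σ n), ?_⟩
  intro S hS v θ hv g α hα _
  have hmem : ∀ n, P.discretize n g ∈ P.discreteSpace n := fun n =>
    P.step_mem_discreteSpace n (P.average n g)
  refine tendstoUniformly_smoothDensity (M := ‖g‖ ^ 2) (fun n => ?_)
    (measureReal_univ_spectralDensity S g).le (fun k => ?_) hα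
  · refine (measureReal_univ_discreteDensity_le (hv n).orthonormal _ _).trans ?_
    gcongr
    exact P.norm_discretize_le hμ0 n g
  · simp_rw [fun n => (hv n).integral_discreteDensity_exp (hmem n) k]
    have h := hS k g
    rw [zpow_natCast, Int.cast_natCast] at h
    rw [spectralDensity, ← h]
    exact P.tendsto_inner_discreteKoopman hμ0 hT hσ k g
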